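/- **Setting.** Let $H$ be a real separable Hilbert space, identified with $H^*$, and $V$ a real reflexive Banach space continuously and densely embedded in $H$, so that $V\subseteq H\cong H^*\subseteq V^*$. Fix $\alpha\in(1,\infty)$ and put $$\mathcal V=L^\alpha([0,\infty);V)\cap L^2([0,\infty);H),\qquad \mathcal H=L^2([0,\infty);H),\qquad \mathcal V^*=L^{\frac{\alpha}{\alpha-1}}([0,\infty);V^*)+L^2([0,\infty);H),$$ where $\mathcal V$ carries the maximum of the two norms and $\mathcal V^*$ the infimum, over all decompositions $u=u_1+u_2$, of the sum of the two norms. Let $k$ satisfy condition (k): $k\in L^1_{\mathrm{loc}}([0,\infty))$, and $k$ is nonnegative, non-increasing and right continuous on $(0,\infty)$ with $\lim_{s\to\infty}k(s)=0$. Let $M^k$ be the unique measure on $(0,\infty)$ with $M^k((s,\infty))=k(s)$ for all $s\in(0,\infty)$, and let $$\psi^k(\lambda)=\int_{(0,\infty)}(1-e^{-\lambda\tau})\,M^k(d\tau),\qquad \lambda>0.$$ For $t\ge 0$ let $\mu^k_t$ be the unique probability measure on $[0,\infty)$ with $\int e^{-\lambda s}\mu_t^k(ds)=e^{-t\psi^k(\lambda)}$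 for all $\lambda>0$. For $f\in\mathcal H$ let $U_sf(r)=\mathbf 1_{[0,\infty)}(r-s)f(r-s)$ and $U^k_tf=\int_{[0,\infty)} U_sf\,\mu^k_t(ds)=f*\mu^k_t$. Let $(\Lambda^k,D(\Lambda^k,\mathcal H))$ be the infinitesimal generator of $(U^k_t)_{t>0}$ on $\mathcal H$. The closure of $\Lambda^k\colon D(\Lambda^k,\mathcal H)\cap\mathcal V\to\mathcal V^*$ as an operator from $\mathcal V$ to $\mathcal V^*$ is again denoted by $\Lambda^k$, and its domain by $\mathcal F^k$. Let $(k*u)(t)=\int_0^tk(t-s)u(s)\,ds$, let $$D(\partial^{*k}_t)=\{u\in\mathcal V^*\mid k*u\in W^{1,1}((0,T);V^*)\ \text{for all }T\in(0,\infty)\},$$ and let $\partial^{*k}_tu=\frac{d}{dt}(k*u)$ be the weak derivative. **Theorem 2.1.** Let $k$ satisfy (k). Then $\Lambda^k\colon D(\Lambda^k,\mathcal H)\cap\mathcal V\to\mathcal V^*$ is closable from $\mathcal V$ to $\mathcal V^*$, so that $\mathcal F^k$ and its closure are well defined, and: (i) $\mathcal F^k\subset D(\partial^{*k}_t)$ and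 $\Lambda^ku=-\partial^{*k}_tu$ for all $u\in\mathcal F^k$. Moreover, for every $u\in\mathcal F^k$, $k*u$ has a $dt$-version in $C([0,\infty);H)$. (ii) For every $\gamma\in(0,\infty)$ the integral defining $\psi^k(\gamma)$ converges, $\psi^k(\gamma)>0$ unless $k$ vanishes identically on $(0,\infty)$, and for all $u\in\mathcal F^k$ $$\int_0^\infty{}_{V^*}\langle\partial^{*k}_tu(s),u(s)\rangle_V\,e^{-\gamma s}\,ds\ \ge\ \tfrac12\,\psi^k(\gamma)\int_0^\infty\|u(s)\|_H^2\,e^{-\gamma s}\,ds,$$ where both integrals converge absolutely. -/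

import Mathlib

open MeasureTheory Set Filter Topology
open scoped ENNReal ContDiff

noncomputable section

namespace GenFrac

/-- Lebesgue measure on the time half-line `[0, ∞)`. -/
abbrev timeMeasure : Measure ℝ := volume.restrict (Ici 0)

/-! ### The kernel, its Lévy measure, its Bernstein function -/

/-- Condition (k): `k ∈ L¹_loc([0,∞))` is nonnegative, non-increasing and right continuous on
`(0,∞)`, with limit `0` at infinity. The value `k 0` is irrelevant (for `k(t) = t^{-β}` it would
be `+∞`), so the pointwise requirements are made on `(0,∞)` only. -/
structure KernelCond (k : ℝ → ℝ) : Prop where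
  locInt : LocallyIntegrableOn k (Ici 0)
  nonneg : ∀ s, 0 < s → 0 ≤ k s
  anti : AntitoneOn k (Ioi 0)
  rightCont : ∀ s, 0 < s → ContinuousWithinAt k (Ici s) s
  lim : Tendsto k atTop (𝓝 0)

/-- The generalized inverse `x ↦ inf {s > 0 | k s ≤ x}` of a non-increasing `k`. -/
def tailInverse (k : ℝ → ℝ) (x : ℝ) : ℝ := sInf {s | 0 < s ∧ k s ≤ x}

/-- The Lévy measure `M^k`, a measure on `ℝ` carried by `(0,∞)`: the image of Lebesgue measure on
`(0,∞)` under the generalized inverse of `k`. Under condition (k) it is the unique measure on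
`(0,∞)` with `M^k((s,∞)) = k(s)` for `s > 0`; see `levyMeasure_Ioi` and `eq_levyMeasure`. -/
def levyMeasure (k : ℝ → ℝ) : Measure ℝ :=
  (Measure.map (tailInverse k) (volume.restrict (Ioi 0))).restrict (Ioi 0)

/-- `ψ^k(γ) = ∫_{(0,∞)} (1 - e^{-τγ}) M^k(dτ)`. -/
def bernsteinFun (k : ℝ → ℝ) (γ : ℝ) : ℝ :=
  ∫ τ, (1 - Real.exp (-(τ * γ))) ∂(levyMeasure k)

lemma lt_tailInverse_iff {k : ℝ → ℝ} (hk : KernelCond k) {x s : ℝ} (hx : 0 < x) (hs : 0 < s) :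
    s < tailInverse k x ↔ x < k s := by
  have hne : {s | 0 < s ∧ k s ≤ x}.Nonempty := by
    have h1 : ∀ᶠ s in atTop, k s < x := hk.lim.eventually (gt_mem_nhds hx)
    obtain ⟨r, hr1, hr2⟩ := (h1.and (eventually_gt_atTop 0)).exists
    exact ⟨r, hr2, hr1.le⟩
  have hbdd : BddBelow {s | 0 < s ∧ k s ≤ x} := ⟨0, fun y hy => hy.1.le⟩
  constructor
  · intro h
    by_contra hc
    exact absurd (csInf_le hbdd ⟨hs, not_lt.mp hc⟩) (not_le.mpr h)
  · intro h
    have h1 : ∀ᶠ r in 𝓝[≥] s, x < k r := (hk.rightCont s hs).eventually (lt_mem_nhds h)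
    obtain ⟨u, hu, hsub⟩ := (mem_nhdsGE_iff_exists_Ico_subset).1 h1
    refine lt_of_lt_of_le (mem_Ioi.1 hu) (le_csInf hne ?_)
    rintro y ⟨hy0, hy⟩
    by_contra hyu
    rcases lt_or_ge y s with hys | hys
    · exact absurd (hk.anti (mem_Ioi.2 hy0) (mem_Ioi.2 hs) hys.le) (not_le.mpr (hy.trans_lt h))
    · exact absurd hy (not_le.mpr (hsub ⟨hys, not_le.mp hyu⟩))

lemma aemeasurable_tailInverse {k : ℝ → ℝ} (hk : KernelCond k) :
    AEMeasurable (tailInverse k) (volume.restrict (Ioi 0)) := by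
  refine aemeasurable_restrict_of_antitoneOn measurableSet_Ioi ?_
  intro x hx y hy hxy
  by_contra hc
  have hc' := not_le.mp hc
  have h0 : 0 ≤ tailInverse k x := Real.sInf_nonneg (fun s hs => hs.1.le)
  obtain ⟨s, hs1, hs2⟩ := exists_between hc'
  have hs : 0 < s := h0.trans_lt hs1
  have h1 := (lt_tailInverse_iff hk hy hs).1 hs2
  exact absurd ((lt_tailInverse_iff hk hx hs).2 (lt_of_le_of_lt hxy h1)) (not_lt.mpr hs1.le)

/-- `M^k((s,∞)) = k(s)` for every `s > 0`. -/
theorem levyMeasure_Ioi {k : ℝ → ℝ} (hk : KernelCond k) {s : ℝ} (hs : 0 < s) :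
    levyMeasure k (Ioi s) = ENNReal.ofReal (k s) := by
  have h1 : Ioi s ∩ Ioi (0 : ℝ) = Ioi s := inter_eq_left.2 (Ioi_subset_Ioi hs.le)
  have h2 : tailInverse k ⁻¹' Ioi s ∩ Ioi 0 = Ioo 0 (k s) := by
    ext x
    simp only [mem_inter_iff, mem_preimage, mem_Ioi, mem_Ioo]
    constructor
    · rintro ⟨h, hx⟩
      exact ⟨hx, (lt_tailInverse_iff hk hx hs).1 h⟩
    · rintro ⟨hx, h⟩
      exact ⟨(lt_tailInverse_iff hk hx hs).2 h, hx⟩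
  rw [levyMeasure, Measure.restrict_apply measurableSet_Ioi, h1,
    Measure.map_apply_of_aemeasurable (aemeasurable_tailInverse hk) measurableSet_Ioi,
    Measure.restrict_apply' measurableSet_Ioi, h2, Real.volume_Ioo, sub_zero]

/-- `M^k` is carried by `(0,∞)`. -/
theorem levyMeasure_Iic (k : ℝ → ℝ) : levyMeasure k (Iic 0) = 0 := by
  rw [levyMeasure, Measure.restrict_apply measurableSet_Iic, Iic_inter_Ioi, Ioc_self,
    measure_empty]

/-- `M^k` is the only measure on `(0,∞)` with `M^k((s,∞)) = k(s)` for every `s > 0`. -/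
theorem eq_levyMeasure {k : ℝ → ℝ} (hk : KernelCond k) (M : Measure ℝ) (h0 : M (Iic 0) = 0)
    (hM : ∀ s, 0 < s → M (Ioi s) = ENNReal.ofReal (k s)) : M = levyMeasure k := by
  have key : ∀ a : ℝ, 0 < a → M.restrict (Ioi a) = (levyMeasure k).restrict (Ioi a) := by
    intro a ha
    have : IsFiniteMeasure (M.restrict (Ioi a)) := ⟨by
      rw [Measure.restrict_apply_univ, hM a ha]; exact ENNReal.ofReal_lt_top⟩
    have : IsFiniteMeasure ((levyMeasure k).restrict (Ioi a)) := ⟨by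
      rw [Measure.restrict_apply_univ, levyMeasure_Ioi hk ha]; exact ENNReal.ofReal_lt_top⟩
    have hpi : ∀ s, M.restrict (Ioi a) (Ioi s) = (levyMeasure k).restrict (Ioi a) (Ioi s) := by
      intro s
      rw [Measure.restrict_apply measurableSet_Ioi, Measure.restrict_apply measurableSet_Ioi,
        Ioi_inter_Ioi, hM _ (lt_sup_of_lt_right ha), levyMeasure_Ioi hk (lt_sup_of_lt_right ha)]
    refine MeasureTheory.ext_of_generate_finite _ (borel_eq_generateFrom_Ioi ℝ ▸
      BorelSpace.measurable_eq) isPiSystem_Ioi ?_ ?_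
    · rintro _ ⟨s, rfl⟩
      exact hpi s
    · rw [Measure.restrict_apply_univ, Measure.restrict_apply_univ, hM a ha, levyMeasure_Ioi hk ha]
  have hcov : (⋃ n : ℕ, Ioi (1 / ((n : ℝ) + 1))) = Ioi 0 := by
    ext x
    simp only [mem_iUnion, mem_Ioi]
    constructor
    · rintro ⟨n, hn⟩
      exact lt_trans (by positivity) hn
    · intro hx
      exact exists_nat_one_div_lt hx
  have hpos : M.restrict (Ioi 0) = (levyMeasure k).restrict (Ioi 0) := by
    rw [← hcov, Measure.restrict_iUnion_congr]
    exact fun n => key _ (by positivity)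
  have hr : ∀ N : Measure ℝ, N (Iic 0) = 0 → N.restrict (Ioi 0) = N := by
    intro N hN
    refine Measure.restrict_eq_self_of_ae_mem ?_
    rw [ae_iff]
    simpa [Iic] using hN
  rw [← hr M h0, hpos, hr _ (levyMeasure_Iic k)]

/-! ### The subordinated shift semigroup and its generator on `𝓗 = L²([0,∞); H)` -/

/-- `μ` is a probability measure carried by `[0,∞)` with Laplace transform
`λ ↦ e^{-t ψ^k(λ)}` on `(0,∞)`. -/
structure IsSubordinatorLaw (k : ℝ → ℝ) (t : ℝ) (μ : Measure ℝ) : Prop where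
  prob : IsProbabilityMeasure μ
  supp : μ (Iio 0) = 0
  laplace : ∀ l : ℝ, 0 < l → ∫ s, Real.exp (-(l * s)) ∂μ = Real.exp (-(t * bernsteinFun k l))

/-- `μ_t^k`: the (unique) probability measure on `[0,∞)` with Laplace transform
`e^{-t ψ^k}`. -/
def subordinatorLaw (k : ℝ → ℝ) (t : ℝ) : Measure ℝ :=
  Classical.epsilon (IsSubordinatorLaw k t)

section Hilbert

variable {H : Type*} [NormedAddCommGroup H] [InnerProductSpace ℝ H]

/-- The shift to the right `(U_s f)(r) = 1_{[0,∞)}(r - s) f(r - s)`. -/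
def shift (s : ℝ) (f : ℝ → H) (r : ℝ) : H := (Ici (0 : ℝ)).indicator f (r - s)

/-- `U_t^k f = ∫ U_s f μ_t^k(ds) = f * μ_t^k`. -/
def subShift (k : ℝ → ℝ) (t : ℝ) (f : ℝ → H) (r : ℝ) : H :=
  ∫ s, shift s f r ∂(subordinatorLaw k t)

/-- `u ∈ D(Λ^k, 𝓗)` and `Λ^k u = g`, for the infinitesimal generator `Λ^k` of `(U_t^k)` on
`𝓗 = L²([0,∞); H)`: both functions lie in `𝓗` and `(U_t^k u - u)/t → g` in `𝓗` as `t ↓ 0`. -/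
def IsGenerator (k : ℝ → ℝ) (u g : ℝ → H) : Prop :=
  MemLp u 2 timeMeasure ∧ MemLp g 2 timeMeasure ∧
    Tendsto (fun t : ℝ => eLpNorm (fun r => t⁻¹ • (subShift k t u r - u r) - g r) 2 timeMeasure)
      (𝓝[>] 0) (𝓝 0)

end Hilbert

/-! ### The Gelfand triple of path spaces -/

section Gelfand

variable {H : Type*} [NormedAddCommGroup H] [InnerProductSpace ℝ H]
  {V : Type*} [NormedAddCommGroup V] [NormedSpace ℝ V]

/-- The embedding `H ≅ H* ⊆ V*` of a Gelfand triple with `ι : V → H`: `h ↦ ⟨h, ι ·⟩_H`. -/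
def toDual (ι : V →L[ℝ] H) (h : H) : StrongDual ℝ V := (innerSL ℝ h).comp ι

/-- Membership in `𝓥 = L^α([0,∞); V) ∩ L²([0,∞); H)`. -/
def MemV (ι : V →L[ℝ] H) (α : ℝ) (u : ℝ → V) : Prop :=
  MemLp u (ENNReal.ofReal α) timeMeasure ∧ MemLp (fun s => ι (u s)) 2 timeMeasure

/-- The norm of `𝓥`. -/
def normV (ι : V →L[ℝ] H) (α : ℝ) (u : ℝ → V) : ℝ≥0∞ :=
  max (eLpNorm u (ENNReal.ofReal α) timeMeasure) (eLpNorm (fun s => ι (u s)) 2 timeMeasure)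

/-- `f = f₁ + f₂` a.e. with `f₁ ∈ L^{α/(α-1)}([0,∞); V*)` and `f₂ ∈ L²([0,∞); H)`. -/
def IsDecomp (ι : V →L[ℝ] H) (α : ℝ) (f f₁ : ℝ → StrongDual ℝ V) (f₂ : ℝ → H) : Prop :=
  MemLp f₁ (ENNReal.ofReal (α / (α - 1))) timeMeasure ∧ MemLp f₂ 2 timeMeasure ∧
    ∀ᵐ s ∂timeMeasure, f s = f₁ s + toDual ι (f₂ s)

/-- Membership in `𝓥* = L^{α/(α-1)}([0,∞); V*) + L²([0,∞); H)`. -/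
def MemVDual (ι : V →L[ℝ] H) (α : ℝ) (f : ℝ → StrongDual ℝ V) : Prop :=
  ∃ f₁ f₂, IsDecomp ι α f f₁ f₂

/-- The norm of `𝓥*`: the infimum of `‖f₁‖ + ‖f₂‖` over all decompositions (`∞` if there is
none). -/
def normVDual (ι : V →L[ℝ] H) (α : ℝ) (f : ℝ → StrongDual ℝ V) : ℝ≥0∞ :=
  ⨅ (f₁ : ℝ → StrongDual ℝ V) (f₂ : ℝ → H) (_ : IsDecomp ι α f f₁ f₂),
    eLpNorm f₁ (ENNReal.ofReal (α / (α - 1))) timeMeasure + eLpNorm f₂ 2 timeMeasure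

/-- The pair `(u, f) ∈ 𝓥 × 𝓥*` lies in the closure of the graph of
`Λ^k : D(Λ^k, 𝓗) ∩ 𝓥 → 𝓥*` (with values in `𝓗 ⊆ 𝓥*`), that is, `u ∈ 𝓕^k` and `Λ^k u = f`. -/
def ClosureGraph (ι : V →L[ℝ] H) (α : ℝ) (k : ℝ → ℝ) (u : ℝ → V) (f : ℝ → StrongDual ℝ V) :
    Prop :=
  MemV ι α u ∧ MemVDual ι α f ∧
    ∃ (un : ℕ → ℝ → V) (gn : ℕ → ℝ → H),
      (∀ n, MemV ι α (un n) ∧ IsGenerator k (fun s => ι (un n s)) (gn n)) ∧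
      Tendsto (fun n => normV ι α (fun s => un n s - u s)) atTop (𝓝 0) ∧
      Tendsto (fun n => normVDual ι α (fun s => toDual ι (gn n s) - f s)) atTop (𝓝 0)

end Gelfand

/-! ### The generalized time-fractional derivative -/

section Derivative

variable {E : Type*} [NormedAddCommGroup E] [NormedSpace ℝ E]

/-- `(k * v)(t) = ∫_0^t k(t - s) v(s) ds`. -/
def conv (k : ℝ → ℝ) (v : ℝ → E) (t : ℝ) : E := ∫ s in Ioo 0 t, k (t - s) • v s

/-- `w ∈ W^{1,1}((0,T); E)` with weak derivative `g`: both are in `L¹((0,T); E)` and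
`∫ φ' w = - ∫ φ g` for all test functions `φ ∈ C_c^∞((0,T))`. -/
def IsSobolevDeriv (T : ℝ) (w g : ℝ → E) : Prop :=
  IntegrableOn w (Ioo 0 T) ∧ IntegrableOn g (Ioo 0 T) ∧
    ∀ φ : ℝ → ℝ, ContDiff ℝ ∞ φ → HasCompactSupport φ → tsupport φ ⊆ Ioo 0 T →
      ∫ t in Ioo 0 T, deriv φ t • w t = -∫ t in Ioo 0 T, φ t • g t

variable {H : Type*} [NormedAddCommGroup H] [InnerProductSpace ℝ H]
  {V : Type*} [NormedAddCommGroup V] [NormedSpace ℝ V]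

/-- `v ∈ D(∂_t^{*k})`: `v ∈ 𝓥*` and `k * v ∈ W^{1,1}((0,T); V*)` for all `T ∈ (0,∞)`. -/
def MemFracDomain (ι : V →L[ℝ] H) (α : ℝ) (k : ℝ → ℝ) (v : ℝ → StrongDual ℝ V) : Prop :=
  MemVDual ι α v ∧ ∀ T, 0 < T → ∃ g, IsSobolevDeriv T (conv k v) g

/-- `∂_t^{*k} v = g`: on each `(0,T)`, `g` is the weak derivative of `k * v`. -/
def IsFracDeriv (k : ℝ → ℝ) (v g : ℝ → E) : Prop :=
  ∀ T, 0 < T → IsSobolevDeriv T (conv k v) g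

end Derivative

end GenFrac

end

noncomputable section

namespace GenFrac

/-! Everything is read off Laplace transforms in time. The subordinated shift multiplies transforms
by `e^{-tψ(λ)}` (`lap_subShift`), so differentiating at `t = 0` turns `Λv = g` into `ĝ(λ) = -ψ(λ)
v̂(λ)` (`IsGenerator.lapRel`). Evaluating a transform at a fixed `λ` is continuous for both
path-space norms, so this relation survives in the closure of the graph (`ClosureGraph.lapRel`).
Since `ψ(λ) = λ k̂(λ)` (`bernsteinFun_eq`) and the Laplace transform is injective
(`ae_eq_zero_of_lap_eq_zero`), the relation says `k * v = -∫₀^· g` (`LapRel.conv_eq`). Hence `-g` is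
the weak derivative of `k * v`, and uniqueness of weak derivatives gives closability.

For continuity in `H`, the identity `‖∫₀^t g‖² = 2 ∫₀^t ⟨g, ∫₀^s g⟩ ds = -2 ∫₀^t ⟨g, k * u⟩ ds` and
Young's inequality for convolutions bound the primitive, uniformly on `[0,T]`, by `‖k‖_{L¹(0,T)}
‖u‖_𝓥 ‖g‖_𝓥*` (`enorm_prim_sq_le`). Applied to differences of approximants, this makes their
primitives uniformly Cauchy in `H`; density of `V` identifies the limit.

For coercivity, Jensen gives `‖U_t v‖² ≤ U_t ‖v‖²` (`norm_subShift_sq_le`). With `N = ∫ ‖v‖² e^{-γs}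
ds`, Young's inequality and the transform of `U_t ‖v‖²` at `γ` bound the weighted integral of `⟨(U_t
v - v)/t, v⟩` by `(e^{-tψ(γ)} - 1) N / (2t)`. Letting `t ↓ 0` gives the estimate for the generator,
and continuity of the duality carries it to the closure.

All of this needs the laws `μ_t` to exist; they are built as infinite sums of independent compound
Poisson variables (`exists_isSubordinatorLaw`). -/

lemma timeMeasure_eq : (timeMeasure : Measure ℝ) = volume.restrict (Ioi 0) :=
  Measure.restrict_congr_set Ioi_ae_eq_Ici.symm

/-! ### Laplace transforms on the half-line: injectivity and convolutions -/

section Laplace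

variable {E : Type*} [NormedAddCommGroup E] [NormedSpace ℝ E]

/-- All the functions `t ↦ e^{-lt} v(t)`, `l > 0`, are integrable on `[0,∞)`. -/
def ExpIntegrable (v : ℝ → E) : Prop :=
  ∀ l : ℝ, 0 < l → Integrable (fun t => Real.exp (-(l * t)) • v t) timeMeasure

/-- The Laplace transform on `[0,∞)`. -/
def lap (l : ℝ) (v : ℝ → E) : E := ∫ t, Real.exp (-(l * t)) • v t ∂timeMeasure

lemma ExpIntegrable.aestronglyMeasurable {v : ℝ → E} (hv : ExpIntegrable v) :
    AEStronglyMeasurable v timeMeasure := by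
  have h1 := (hv 1 one_pos).aestronglyMeasurable
  have h2 : AEStronglyMeasurable (fun t : ℝ => Real.exp (1 * t)) timeMeasure :=
    (by fun_prop : Continuous fun t : ℝ => Real.exp (1 * t)).aestronglyMeasurable
  refine (h2.smul h1).congr (Eventually.of_forall fun t => ?_)
  simp [smul_smul, ← Real.exp_add]

lemma ExpIntegrable.integrableOn {v : ℝ → E} (hv : ExpIntegrable v) (T : ℝ) :
    IntegrableOn v (Icc 0 T) := by
  have h1 : IntegrableOn (fun t => Real.exp (-(1 * t)) • v t) (Icc 0 T) :=
    IntegrableOn.mono_set (hv 1 one_pos) Icc_subset_Ici_self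
  have h2 : ContinuousOn (fun t : ℝ => Real.exp (1 * t)) (Icc 0 T) := by fun_prop
  refine (h1.continuousOn_smul h2 isCompact_Icc).congr (Eventually.of_forall fun t => ?_)
  simp [smul_smul, ← Real.exp_add]

lemma ExpIntegrable.add {v w : ℝ → E} (hv : ExpIntegrable v) (hw : ExpIntegrable w) :
    ExpIntegrable (fun t => v t + w t) := fun l hl => by
  simpa only [smul_add] using! (hv l hl).add (hw l hl)

lemma ExpIntegrable.sub {v w : ℝ → E} (hv : ExpIntegrable v) (hw : ExpIntegrable w) :
    ExpIntegrable (fun t => v t - w t) := fun l hl => by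
  simpa only [smul_sub] using! (hv l hl).sub (hw l hl)

lemma lap_add {v w : ℝ → E} (hv : ExpIntegrable v) (hw : ExpIntegrable w) {l : ℝ} (hl : 0 < l) :
    lap l (fun t => v t + w t) = lap l v + lap l w := by
  simp only [lap, smul_add]
  exact integral_add (hv l hl) (hw l hl)

lemma lap_sub {v w : ℝ → E} (hv : ExpIntegrable v) (hw : ExpIntegrable w) {l : ℝ} (hl : 0 < l) :
    lap l (fun t => v t - w t) = lap l v - lap l w := by
  simp only [lap, smul_sub]
  exact integral_sub (hv l hl) (hw l hl)

lemma ExpIntegrable.comp_clm {F : Type*} [NormedAddCommGroup F] [NormedSpace ℝ F]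
    (A : E →L[ℝ] F) {v : ℝ → E} (hv : ExpIntegrable v) : ExpIntegrable (fun t => A (v t)) :=
  fun l hl => by simpa only [map_smul] using A.integrable_comp (hv l hl)

lemma lap_comp_clm {F : Type*} [NormedAddCommGroup F] [NormedSpace ℝ F] [CompleteSpace E]
    [CompleteSpace F] (A : E →L[ℝ] F) {v : ℝ → E} (hv : ExpIntegrable v) {l : ℝ} (hl : 0 < l) :
    lap l (fun t => A (v t)) = A (lap l v) := by
  simp only [lap, ← map_smul]
  exact A.integral_comp_comm (hv l hl)

/-- The monomial `x ^ j` at `x = e^{-t}`, weighted by `e^{-t}`, integrates to the transform at `1 +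
j`. The extra factor keeps the constant term of the polynomial integrable. -/
lemma integral_exp_mul_polynomial_smul {v : ℝ → E} (hv : ExpIntegrable v)
    (h0 : ∀ l : ℝ, 0 < l → lap l v = 0) (p : Polynomial ℝ) :
    Integrable (fun t => (Real.exp (-t) * p.eval (Real.exp (-t))) • v t) timeMeasure ∧
      ∫ t, (Real.exp (-t) * p.eval (Real.exp (-t))) • v t ∂timeMeasure = 0 := by
  have hterm : ∀ (j : ℕ) (t : ℝ), (Real.exp (-t) * (p.coeff j * Real.exp (-t) ^ j)) • v t
      = p.coeff j • (Real.exp (-((1 + (j : ℝ)) * t)) • v t) := by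
    intro j t
    rw [smul_smul, ← Real.exp_nat_mul, mul_left_comm, ← Real.exp_add]
    ring_nf
  have heq : (fun t => (Real.exp (-t) * p.eval (Real.exp (-t))) • v t) = fun t =>
      ∑ j ∈ Finset.range (p.natDegree + 1),
        p.coeff j • (Real.exp (-((1 + (j : ℝ)) * t)) • v t) := by
    funext t
    rw [Polynomial.eval_eq_sum_range, Finset.mul_sum, Finset.sum_smul]
    exact Finset.sum_congr rfl fun j _ => hterm j t
  have hint : ∀ j ∈ Finset.range (p.natDegree + 1),
      Integrable (fun t => p.coeff j • (Real.exp (-((1 + (j : ℝ)) * t)) • v t)) timeMeasure :=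
    fun j _ => (hv _ (by positivity)).smul _
  rw [heq]
  refine ⟨integrable_finsetSum _ hint, ?_⟩
  rw [integral_finsetSum _ hint]
  refine Finset.sum_eq_zero fun j _ => ?_
  have := h0 (1 + (j : ℝ)) (by positivity)
  rw [lap] at this
  rw [integral_smul, this, smul_zero]

/-- A function on `[0,∞)` with vanishing Laplace transform vanishes almost everywhere. -/
theorem ae_eq_zero_of_lap_eq_zero [CompleteSpace E] {v : ℝ → E} (hv : ExpIntegrable v)
    (h0 : ∀ l : ℝ, 0 < l → lap l v = 0) : v =ᵐ[timeMeasure] 0 := by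
  have hloc : LocallyIntegrableOn v (Ioi 0) := by
    refine LocallyIntegrableOn.mono_set ?_ Ioi_subset_Ici_self
    refine (locallyIntegrableOn_iff isClosed_Ici.isLocallyClosed).2 fun K hK hKc => ?_
    obtain ⟨T, hT⟩ := hKc.bddAbove
    exact (hv.integrableOn T).mono_set fun t ht => ⟨hK ht, hT ht⟩
  have key := isOpen_Ioi.ae_eq_zero_of_integral_contDiff_smul_eq_zero hloc ?_
  · have hr : (timeMeasure : Measure ℝ) = volume.restrict (Ioi 0) :=
      timeMeasure_eq
    rw [hr]
    exact (ae_restrict_iff' measurableSet_Ioi).2 key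
  intro φ hφ hφc hφs
  have hφ0 : ∀ t : ℝ, t ≤ 0 → φ t = 0 := fun t ht => by
    by_contra h
    exact absurd (hφs (subset_tsupport _ h)) (not_lt.2 ht)
  obtain ⟨b, hb⟩ := hφc.isCompact.bddAbove
  have hφb : ∀ t, b < t → φ t = 0 := fun t ht => by
    by_contra h
    exact absurd (hb (subset_tsupport _ h)) (not_le.2 ht)
  -- The substitution `x = e^{-t}` moves the test function to `[0,1]`, where Weierstrass applies;
  -- dividing by `x` leaves the factor `e^{-t}` required for integrability.
  set q : ℝ → ℝ := fun x => φ (-Real.log x) / x with hq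
  have hqc : ContinuousOn q (Icc 0 1) := by
    intro x hx
    -- Near `x = 0` the quotient vanishes because `φ` vanishes for large `t`; at `x = 0` itself
    -- division by zero yields the right value `0`.
    rcases hx.1.eq_or_lt with rfl | hx0
    · have h1 : ∀ᶠ y in 𝓝 (0 : ℝ), y ∈ Icc (0 : ℝ) 1 → q y = 0 := by
        filter_upwards [Iio_mem_nhds (Real.exp_pos (-b))] with y hy hy1
        rcases hy1.1.eq_or_lt with rfl | hy0
        · simp [hq]
        · have : b < -Real.log y := by
            rw [lt_neg, ← Real.log_exp (-b)]
            exact Real.log_lt_log hy0 hy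
          simp [hq, hφb _ this]
      refine (continuousWithinAt_const (b := (0 : ℝ))).congr_of_eventuallyEq ?_ (by simp [hq])
      exact eventually_nhdsWithin_iff.2 h1
    · exact (((hφ.continuous.continuousAt.comp (Real.continuousAt_log hx0.ne').neg).div
        continuousAt_id hx0.ne')).continuousWithinAt
  have hqe : ∀ t, φ t = Real.exp (-t) * q (Real.exp (-t)) := by
    intro t
    simp only [hq, Real.log_exp, neg_neg]
    field_simp
  have hE : Integrable (fun t => Real.exp (-t) • v t) timeMeasure := by
    simpa using hv 1 one_pos
  have hvφ : Integrable (fun t => φ t • v t) timeMeasure := by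
    obtain ⟨C, hC⟩ := isCompact_Icc.exists_bound_of_continuousOn hqc
    have hmeas : AEStronglyMeasurable (fun t => φ t • v t) timeMeasure :=
      hφ.continuous.aestronglyMeasurable.smul hv.aestronglyMeasurable
    refine (hE.norm.const_mul C).mono' hmeas ?_
    filter_upwards [ae_restrict_mem measurableSet_Ici] with t ht
    have h1 : Real.exp (-t) ∈ Icc (0 : ℝ) 1 :=
      ⟨(Real.exp_pos _).le, Real.exp_le_one_iff.2 (by simpa using ht)⟩
    have h2 := hC _ h1
    rw [norm_smul, norm_smul, hqe, norm_mul]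
    calc _ = ‖q (Real.exp (-t))‖ * (‖Real.exp (-t)‖ * ‖v t‖) := by ring
      _ ≤ _ := by gcongr
  have hEq : ∫ x, φ x • v x = ∫ t, φ t • v t ∂timeMeasure := by
    refine (setIntegral_eq_integral_of_forall_compl_eq_zero fun t ht => ?_).symm
    rw [hφ0 t (not_le.1 ht).le, zero_smul]
  rw [hEq, ← norm_eq_zero]
  refine le_antisymm (le_of_forall_pos_le_add fun ε hε => ?_) (norm_nonneg _)
  set C := ∫ t, ‖Real.exp (-t) • v t‖ ∂timeMeasure with hC
  have hC0 : 0 ≤ C := integral_nonneg fun _ => norm_nonneg _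
  -- The `+ 1` covers the case `C = 0`.
  obtain ⟨p, hp⟩ := exists_polynomial_near_of_continuousOn 0 1 q hqc (ε / (C + 1))
    (by positivity)
  obtain ⟨hp1, hp2⟩ := integral_exp_mul_polynomial_smul hv h0 p
  have hsub : ∫ t, φ t • v t ∂timeMeasure
      = ∫ t, (φ t • v t - (Real.exp (-t) * p.eval (Real.exp (-t))) • v t) ∂timeMeasure := by
    rw [integral_sub hvφ hp1, hp2, sub_zero]
  rw [hsub, zero_add]
  calc _ ≤ ∫ t, ε / (C + 1) * ‖Real.exp (-t) • v t‖ ∂timeMeasure := by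
        refine norm_integral_le_of_norm_le (hE.norm.const_mul _) ?_
        filter_upwards [ae_restrict_mem measurableSet_Ici] with t ht
        have h1 : Real.exp (-t) ∈ Icc (0 : ℝ) 1 :=
          ⟨(Real.exp_pos _).le, Real.exp_le_one_iff.2 (by simpa using ht)⟩
        have h2 := (hp _ h1).le
        rw [hqe, ← sub_smul, ← mul_sub, norm_smul, norm_smul, norm_mul, Real.norm_eq_abs,
          Real.norm_eq_abs, abs_sub_comm]
        calc _ = |p.eval (Real.exp (-t)) - q (Real.exp (-t))| * (|Real.exp (-t)| * ‖v t‖) := by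
              ring
          _ ≤ _ := by gcongr
    _ = ε / (C + 1) * C := by rw [integral_const_mul]
    _ ≤ ε := by
        rw [div_mul_eq_mul_div, div_le_iff₀ (by positivity)]
        nlinarith

/-- Laplace transform of a convolution. -/
theorem lap_conv [CompleteSpace E] {κ : ℝ → ℝ} {v : ℝ → E} (hκ : ExpIntegrable κ)
    (hv : ExpIntegrable v) :
    ExpIntegrable (conv κ v) ∧ ∀ l : ℝ, 0 < l → lap l (conv κ v) = lap l κ • lap l v := by
  have hr : (timeMeasure : Measure ℝ) = volume.restrict (Ioi 0) := timeMeasure_eq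
  have key : ∀ l : ℝ, 0 < l →
      Integrable (fun t => Real.exp (-(l * t)) • conv κ v t) timeMeasure ∧
        lap l (conv κ v) = lap l κ • lap l v := by
    intro l hl
    -- Since `e^{-lt} = e^{-l(t-s)} e^{-ls}`, weighting and cutting off both factors turns `conv`
    -- into an ordinary convolution of integrable functions on the line.
    set K : ℝ → ℝ := (Ioi 0).indicator fun t => Real.exp (-(l * t)) • κ t with hK
    set W : ℝ → E := (Ioi 0).indicator fun t => Real.exp (-(l * t)) • v t with hW
    have hKi : Integrable K :=
      (integrable_indicator_iff measurableSet_Ioi).2 (by have := hκ l hl; rwa [hr] at this)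
    have hWi : Integrable W :=
      (integrable_indicator_iff measurableSet_Ioi).2 (by have := hv l hl; rwa [hr] at this)
    set B : E →L[ℝ] ℝ →L[ℝ] E := (ContinuousLinearMap.lsmul ℝ ℝ).flip with hB
    have hcv : convolution W K B volume
        = (Ioi 0).indicator fun t => Real.exp (-(l * t)) • conv κ v t := by
      funext t
      rw [convolution]
      have h1 : (fun s => B (W s) (K (t - s))) = (Ioo 0 t).indicator
          fun s => Real.exp (-(l * t)) • (κ (t - s) • v s) := by
        funext s
        by_cases hs : s ∈ Ioo 0 t
        · rw [indicator_of_mem hs, hW, hK, indicator_of_mem (mem_Ioi.2 hs.1),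
            indicator_of_mem (mem_Ioi.2 (sub_pos.2 hs.2))]
          simp only [hB, ContinuousLinearMap.flip_apply, ContinuousLinearMap.lsmul_apply,
            smul_smul, smul_eq_mul]
          congr 1
          have : Real.exp (-(l * t)) = Real.exp (-(l * (t - s))) * Real.exp (-(l * s)) := by
            rw [← Real.exp_add]; ring_nf
          rw [this]; ring
        · rw [indicator_of_notMem hs]
          rcases not_and_or.1 hs with h | h
          · rw [hW, indicator_of_notMem (s := Ioi (0 : ℝ)) h]; simp
          · rw [hK, indicator_of_notMem (s := Ioi (0 : ℝ)) (a := t - s)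
              (fun h' => h (sub_pos.1 h'))]; simp
      rw [h1, integral_indicator measurableSet_Ioo, integral_smul]
      by_cases ht : t ∈ Ioi (0 : ℝ)
      · rw [indicator_of_mem ht]; rfl
      · rw [indicator_of_notMem ht, Ioo_eq_empty (fun h => ht h)]; simp
    have hint : Integrable (convolution W K B volume) := hWi.integrable_convolution B hKi
    have hval := integral_convolution (L := B) hWi hKi
    rw [hcv] at hint hval
    rw [integral_indicator measurableSet_Ioi, hW, hK, integral_indicator measurableSet_Ioi,
      integral_indicator measurableSet_Ioi] at hval
    rw [integrable_indicator_iff measurableSet_Ioi] at hint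
    simp only [lap]
    rw [hr]
    exact ⟨hint, hval⟩
  exact ⟨fun l hl => (key l hl).1, fun l hl => (key l hl).2⟩

end Laplace

/-! ### The Bernstein function as `λ` times the transform of the kernel -/

section Bernstein

variable {k : ℝ → ℝ}

lemma integrable_exp_neg_timeMeasure {l : ℝ} (hl : 0 < l) :
    Integrable (fun t : ℝ => Real.exp (-(l * t))) timeMeasure := by
  rw [timeMeasure_eq]
  simpa only [neg_mul] using! exp_neg_integrableOn_Ioi 0 hl

/-- Local integrability handles `[0,1]`; beyond `1`, monotonicity bounds `k` by `k 1`. -/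
theorem KernelCond.expIntegrable (hk : KernelCond k) : ExpIntegrable k := by
  intro l hl
  have hcont : Continuous fun t : ℝ => Real.exp (-(l * t)) := by fun_prop
  have h1 : IntegrableOn (fun t => Real.exp (-(l * t)) • k t) (Icc 0 1) :=
    (hk.locInt.integrableOn_compact_subset Icc_subset_Ici_self
      isCompact_Icc).continuousOn_smul hcont.continuousOn isCompact_Icc
  have h2 : IntegrableOn (fun t => Real.exp (-(l * t)) • k t) (Ioi 1) := by
    have hd : IntegrableOn (fun t => Real.exp (-(l * t)) * k 1) (Ioi 1) :=
      Integrable.mul_const (by simpa only [neg_mul] using! exp_neg_integrableOn_Ioi 1 hl) _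
    refine Integrable.mono' hd ?_ ?_
    · have hm : AEStronglyMeasurable k (volume.restrict (Ioi 1)) :=
        hk.locInt.aestronglyMeasurable.mono_set (Ioi_subset_Ici zero_le_one)
      exact hcont.aestronglyMeasurable.smul hm
    · filter_upwards [ae_restrict_mem measurableSet_Ioi] with t ht
      have ht0 : (0 : ℝ) < t := zero_lt_one.trans (mem_Ioi.1 ht)
      rw [norm_smul, Real.norm_of_nonneg (Real.exp_pos _).le,
        Real.norm_of_nonneg (hk.nonneg t ht0)]
      gcongr
      exact hk.anti (mem_Ioi.2 one_pos) (mem_Ioi.2 ht0) (le_of_lt (mem_Ioi.1 ht))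
  have h3 := h1.union h2
  rwa [Icc_union_Ioi_eq_Ici zero_le_one] at h3

lemma KernelCond.lap_nonneg (hk : KernelCond k) (l : ℝ) : 0 ≤ lap l k := by
  rw [lap, timeMeasure_eq]
  exact setIntegral_nonneg measurableSet_Ioi fun t ht =>
    smul_nonneg (Real.exp_pos _).le (hk.nonneg t ht)

lemma ae_pos_levyMeasure (k : ℝ → ℝ) : ∀ᵐ τ ∂levyMeasure k, 0 < τ := by
  have h : ∀ᵐ τ ∂levyMeasure k, τ ∈ Ioi (0 : ℝ) := ae_restrict_mem measurableSet_Ioi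
  exact h

/-- Layer cake: `1 - e^{-τl}` is the primitive of `l e^{-tl}`, and the tail `M((t,∞))` is `k t`. As
the right side is finite, this also gives convergence of the integral defining `ψ`. -/
lemma lintegral_levyMeasure (hk : KernelCond k) {l : ℝ} (hl : 0 < l) :
    ∫⁻ τ, ENNReal.ofReal (1 - Real.exp (-(τ * l))) ∂levyMeasure k
      = ENNReal.ofReal (l * lap l k) := by
  have hg : ∀ x : ℝ, ∫ t in (0 : ℝ)..x, l * Real.exp (-(t * l)) = 1 - Real.exp (-(x * l)) := by
    intro x
    have hd : ∀ t ∈ uIcc 0 x, HasDerivAt (fun t : ℝ => -Real.exp (-(t * l)))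
        (l * Real.exp (-(t * l))) t := by
      intro t _
      have h1 : HasDerivAt (fun t : ℝ => -(t * l)) (-(1 * l)) t :=
        ((hasDerivAt_id t).mul_const l).neg
      refine h1.exp.neg.congr_deriv ?_
      ring
    rw [intervalIntegral.integral_eq_sub_of_hasDerivAt hd
      ((by fun_prop : Continuous fun t : ℝ => l * Real.exp (-(t * l))).intervalIntegrable _ _)]
    simp only [zero_mul, neg_zero, Real.exp_zero]
    ring
  have hlc := lintegral_comp_eq_lintegral_meas_lt_mul (levyMeasure k) (f := fun τ => τ)
    (g := fun t => l * Real.exp (-(t * l)))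
    ((ae_pos_levyMeasure k).mono fun τ h => h.le) aemeasurable_id
    (fun t _ => (by fun_prop : Continuous fun t : ℝ => l * Real.exp (-(t * l))).intervalIntegrable
      _ _) (Eventually.of_forall fun t => by positivity)
  simp only [hg] at hlc
  rw [hlc]
  have hi := hk.expIntegrable l hl
  rw [lap]
  rw [timeMeasure_eq] at hi ⊢
  rw [← integral_const_mul, ofReal_integral_eq_lintegral_ofReal (hi.const_mul l)]
  · refine setLIntegral_congr_fun measurableSet_Ioi fun t ht => ?_
    have h1 : levyMeasure k {a | t < a} = ENNReal.ofReal (k t) := levyMeasure_Ioi hk ht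
    simp only [h1]
    rw [← ENNReal.ofReal_mul (hk.nonneg t ht)]
    congr 1
    rw [smul_eq_mul, mul_comm t l]
    ring
  · filter_upwards [ae_restrict_mem measurableSet_Ioi] with t ht
    exact mul_nonneg hl.le (smul_nonneg (Real.exp_pos _).le (hk.nonneg t ht))

lemma one_sub_exp_nonneg {τ l : ℝ} (hτ : 0 ≤ τ) (hl : 0 ≤ l) : 0 ≤ 1 - Real.exp (-(τ * l)) :=
  sub_nonneg.2 (Real.exp_le_one_iff.2 (neg_nonpos.2 (mul_nonneg hτ hl)))

theorem integrable_levyMeasure (hk : KernelCond k) {l : ℝ} (hl : 0 < l) :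
    Integrable (fun τ => 1 - Real.exp (-(τ * l))) (levyMeasure k) := by
  refine ⟨(by fun_prop : Continuous fun τ : ℝ => 1 - Real.exp (-(τ * l))).aestronglyMeasurable, ?_⟩
  rw [hasFiniteIntegral_iff_ofReal
    ((ae_pos_levyMeasure k).mono fun τ h => one_sub_exp_nonneg h.le hl.le),
    lintegral_levyMeasure hk hl]
  exact ENNReal.ofReal_lt_top

theorem bernsteinFun_eq (hk : KernelCond k) {l : ℝ} (hl : 0 < l) :
    bernsteinFun k l = l * lap l k := by
  rw [bernsteinFun, integral_eq_lintegral_of_nonneg_ae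
    ((ae_pos_levyMeasure k).mono fun τ h => one_sub_exp_nonneg h.le hl.le)
    (integrable_levyMeasure hk hl).aestronglyMeasurable, lintegral_levyMeasure hk hl,
    ENNReal.toReal_ofReal (mul_nonneg hl.le (hk.lap_nonneg l))]

theorem bernsteinFun_pos (hk : KernelCond k) {l : ℝ} (hl : 0 < l) (hne : ∃ s, 0 < s ∧ k s ≠ 0) :
    0 < bernsteinFun k l := by
  obtain ⟨s, hs, hks⟩ := hne
  rw [bernsteinFun, integral_pos_iff_support_of_nonneg_ae
    ((ae_pos_levyMeasure k).mono fun τ h => one_sub_exp_nonneg h.le hl.le)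
    (integrable_levyMeasure hk hl)]
  refine lt_of_lt_of_le ?_ (measure_mono (s := Ioi s) ?_)
  · rw [levyMeasure_Ioi hk hs]
    exact ENNReal.ofReal_pos.2 (lt_of_le_of_ne (hk.nonneg s hs) hks.symm)
  · intro τ hτ
    have hτ0 : 0 < τ := hs.trans hτ
    have : Real.exp (-(τ * l)) < 1 := Real.exp_lt_one_iff.2 (neg_lt_zero.2 (mul_pos hτ0 hl))
    exact (sub_pos.2 this).ne'

/-- Needed to exclude mass at infinity when `μ_t` is constructed. The integrand at `λ = 1`
dominates. -/
lemma tendsto_bernsteinFun_zero (hk : KernelCond k) :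
    Tendsto (fun m : ℕ => bernsteinFun k (1 / ((m : ℝ) + 1))) atTop (𝓝 0) := by
  have h0 : ∫ _, (0 : ℝ) ∂levyMeasure k = 0 := integral_zero _ _
  rw [← h0]
  simp only [bernsteinFun]
  refine tendsto_integral_of_dominated_convergence (fun τ => 1 - Real.exp (-(τ * 1)))
    (fun m => (integrable_levyMeasure hk (by positivity)).aestronglyMeasurable)
    (integrable_levyMeasure hk one_pos) (fun m => ?_) ?_
  · filter_upwards [ae_pos_levyMeasure k] with τ hτ
    rw [Real.norm_of_nonneg (one_sub_exp_nonneg hτ.le (by positivity))]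
    gcongr
    rw [div_le_one (by positivity)]
    simp
  · refine Eventually.of_forall fun τ => ?_
    have h1 : Tendsto (fun m : ℕ => 1 - Real.exp (-(τ * (1 / ((m : ℝ) + 1))))) atTop
        (𝓝 (1 - Real.exp (-(τ * 0)))) :=
      ((tendsto_one_div_add_atTop_nhds_zero_nat.const_mul τ).neg.rexp).const_sub 1
    simpa using h1

end Bernstein

/-! ### Existence of the subordinator laws -/

section Subordinator

open ProbabilityTheory NNReal

/-- The character `x ↦ e^{-lx}` of the additive monoid `[0,∞)`. -/
def expChar (l : ℝ) (x : ℝ≥0) : ℝ≥0∞ := ENNReal.ofReal (Real.exp (-(l * x)))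

lemma measurable_expChar (l : ℝ) : Measurable (expChar l) :=
  ENNReal.measurable_ofReal.comp
    (by fun_prop : Continuous fun x : ℝ≥0 => Real.exp (-(l * x))).measurable

lemma expChar_add (l : ℝ) (x y : ℝ≥0) : expChar l (x + y) = expChar l x * expChar l y := by
  rw [expChar, expChar, expChar, ← ENNReal.ofReal_mul (Real.exp_pos _).le, ← Real.exp_add]
  congr 2
  push_cast
  ring

lemma expChar_sum (l : ℝ) (x : ℕ → ℝ≥0) (s : Finset ℕ) :
    expChar l (∑ j ∈ s, x j) = ∏ j ∈ s, expChar l (x j) := by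
  classical
  induction s using Finset.induction_on with
  | empty => simp [expChar]
  | insert a s ha ih => rw [Finset.sum_insert ha, Finset.prod_insert ha, expChar_add, ih]

/-- Convolution powers of a measure on `[0,∞)`. -/
def convPow (ρ : Measure ℝ≥0) : ℕ → Measure ℝ≥0
  | 0 => Measure.dirac 0
  | n + 1 => (convPow ρ n) ∗ ρ

lemma lintegral_convPow (ρ : Measure ℝ≥0) [IsProbabilityMeasure ρ] (l : ℝ) (n : ℕ) :
    ∫⁻ x, expChar l x ∂convPow ρ n = (∫⁻ x, expChar l x ∂ρ) ^ n := by
  induction n with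
  | zero => simp [convPow, expChar]
  | succ n ih =>
    rw [convPow, Measure.lintegral_conv (measurable_expChar l)]
    simp_rw [expChar_add, lintegral_const_mul _ (measurable_expChar l)]
    rw [lintegral_mul_const _ (measurable_expChar l), ih, pow_succ]

/-- Existence of the compound Poisson law with jump law `ρ` and intensity `t`. -/
lemma exists_compoundPoisson (ρ : Measure ℝ≥0) [IsProbabilityMeasure ρ] {t : ℝ} (ht : 0 ≤ t) :
    ∃ P : Measure ℝ≥0, IsProbabilityMeasure P ∧ ∀ l : ℝ, 0 ≤ l →
      ∫⁻ x, expChar l x ∂P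
        = ENNReal.ofReal (Real.exp (-(t * ∫ x, (1 - Real.exp (-(l * x))) ∂ρ))) := by
  -- A Poisson mixture of convolution powers: if `a` is the transform of `ρ`, the transform of the
  -- mixture is `∑ e^{-t} (ta)^n / n! = e^{-t(1-a)}`.
  set P : Measure ℝ≥0 := Measure.sum fun n : ℕ =>
    ENNReal.ofReal (Real.exp (-t) * (t ^ n / n.factorial)) • convPow ρ n with hP
  have hL : ∀ l : ℝ, 0 ≤ l → ∫⁻ x, expChar l x ∂P
        = ENNReal.ofReal (Real.exp (-(t * ∫ x, (1 - Real.exp (-(l * x))) ∂ρ))) := by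
    intro l hl
    have hint : Integrable (fun x : ℝ≥0 => Real.exp (-(l * x))) ρ := by
      refine Integrable.mono' (integrable_const (1 : ℝ))
        (by fun_prop : Continuous fun x : ℝ≥0 => Real.exp (-(l * x))).aestronglyMeasurable
        (Eventually.of_forall fun x => ?_)
      rw [Real.norm_of_nonneg (Real.exp_pos _).le]
      exact Real.exp_le_one_iff.2 (neg_nonpos.2 (mul_nonneg hl x.2))
    set a := ∫ x : ℝ≥0, Real.exp (-(l * x)) ∂ρ with ha
    have ha0 : 0 ≤ a := integral_nonneg fun x => (Real.exp_pos _).le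
    have ha' : ∫⁻ x, expChar l x ∂ρ = ENNReal.ofReal a :=
      (ofReal_integral_eq_lintegral_ofReal hint
        (Eventually.of_forall fun x => (Real.exp_pos _).le)).symm
    have h1 : ∫ x : ℝ≥0, (1 - Real.exp (-(l * x))) ∂ρ = 1 - a := by
      rw [integral_sub (integrable_const _) hint]; simp [ha]
    have hs : HasSum (fun n : ℕ => Real.exp (-t) * ((t * a) ^ n / n.factorial))
        (Real.exp (-t) * Real.exp (t * a)) := by
      rw [Real.exp_eq_exp_ℝ]
      exact (NormedSpace.expSeries_div_hasSum_exp (t * a)).mul_left _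
    rw [hP, lintegral_sum_measure]
    simp_rw [lintegral_smul_measure, lintegral_convPow, ha', smul_eq_mul]
    rw [h1]
    have h2 : Real.exp (-(t * (1 - a))) = Real.exp (-t) * Real.exp (t * a) := by
      rw [← Real.exp_add]; ring_nf
    rw [h2, ← hs.tsum_eq, ENNReal.ofReal_tsum_of_nonneg (fun n => by positivity) hs.summable]
    refine tsum_congr fun n => ?_
    rw [← ENNReal.ofReal_pow ha0, ← ENNReal.ofReal_mul (by positivity)]
    congr 1
    rw [mul_pow]; ring
  refine ⟨P, ⟨?_⟩, hL⟩
  -- The transform at `l = 0` is the total mass.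
  have := hL 0 le_rfl
  simpa [expChar] using this

/-- Superposition of countably many independent compound Poisson laws. -/
theorem exists_law_of_hasSum (ρ : ℕ → Measure ℝ≥0) [∀ j, IsProbabilityMeasure (ρ j)] (ψ : ℝ → ℝ)
    (hψ : ∀ l : ℝ, 0 < l → HasSum (fun j => ∫ x, (1 - Real.exp (-(l * x))) ∂ρ j) (ψ l))
    (hψ0 : Tendsto (fun m : ℕ => ψ (1 / ((m : ℝ) + 1))) atTop (𝓝 0)) {t : ℝ} (ht : 0 ≤ t) :
    ∃ μ : Measure ℝ, IsProbabilityMeasure μ ∧ μ (Iio 0) = 0 ∧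
      ∀ l : ℝ, 0 < l → ∫ s, Real.exp (-(l * s)) ∂μ = Real.exp (-(t * ψ l)) := by
  choose P hPp hPL using fun j => exists_compoundPoisson (ρ j) ht
  set Q : Measure (ℕ → ℝ≥0) := Measure.infinitePi P with hQ
  set S : ℕ → (ℕ → ℝ≥0) → ℝ≥0 := fun n η => ∑ j ∈ Finset.range n, η j with hS
  have hSm : ∀ n, Measurable (S n) := fun n => by fun_prop
  have hLn : ∀ l : ℝ, 0 ≤ l → ∀ n, ∫⁻ η, expChar l (S n η) ∂Q = ENNReal.ofReal
      (Real.exp (-(t * ∑ j ∈ Finset.range n, ∫ x, (1 - Real.exp (-(l * x))) ∂ρ j))) := by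
    intro l hl n
    simp_rw [hS, expChar_sum]
    rw [lintegral_prod_eq_prod_lintegral_of_indepFun (Finset.range n)
      (fun j (η : ℕ → ℝ≥0) => expChar l (η j))
      (iIndepFun_infinitePi (X := fun _ => expChar l) fun _ => measurable_expChar l)
      (fun j => (measurable_expChar l).comp (measurable_pi_apply j))]
    have h1 : ∀ j, ∫⁻ η : ℕ → ℝ≥0, expChar l (η j) ∂Q = ENNReal.ofReal
        (Real.exp (-(t * ∫ x, (1 - Real.exp (-(l * x))) ∂ρ j))) := by
      intro j
      rw [← hPL j l hl, ← lintegral_map (f := expChar l) (measurable_expChar l)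
        (measurable_pi_apply j), hQ, Measure.infinitePi_map_eval]
    rw [Finset.prod_congr rfl fun j _ => h1 j,
      ← ENNReal.ofReal_prod_of_nonneg fun j _ => (Real.exp_pos _).le, ← Real.exp_sum,
      Finset.mul_sum, Finset.sum_neg_distrib]
  have hLlim : ∀ l : ℝ, 0 < l → Tendsto (fun n => ∫⁻ η, expChar l (S n η) ∂Q) atTop
      (𝓝 (ENNReal.ofReal (Real.exp (-(t * ψ l))))) := by
    intro l hl
    simp_rw [hLn l hl.le]
    exact (ENNReal.continuous_ofReal.tendsto _).comp
      (((hψ l hl).tendsto_sum_nat.const_mul t).neg.rexp)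
  have hexp_le : ∀ l : ℝ, 0 < l → ∀ x : ℝ≥0, expChar l x ≤ 1 := fun l hl x =>
    ENNReal.ofReal_le_one.2 (Real.exp_le_one_iff.2 (neg_nonpos.2 (mul_nonneg hl.le x.2)))
  have hsum : ∀ᵐ η ∂Q, Summable η := by
    set A : Set (ℕ → ℝ≥0) := {η | Summable η} with hA
    have hAm : MeasurableSet A := by
      have : A = {η | ∑' j, (η j : ℝ≥0∞) ≠ ⊤} := by
        ext η
        exact ENNReal.tsum_coe_ne_top_iff_summable.symm
      rw [this]
      have hm : Measurable fun η : ℕ → ℝ≥0 => ∑' j, (η j : ℝ≥0∞) :=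
        Measurable.tsum fun j => (measurable_pi_apply j).coe_nnreal_ennreal
      exact (hm (measurableSet_singleton ⊤)).compl
    -- Off `A` the partial sums tend to infinity, so their characters tend to `0` there and the
    -- limiting transform is carried by `A`. Letting `l → 0` afterwards forces `Q A = 1`.
    have hbound : ∀ l : ℝ, 0 < l → ENNReal.ofReal (Real.exp (-(t * ψ l))) ≤ Q A := by
      intro l hl
      have hlim : Tendsto (fun n => ∫⁻ η, Aᶜ.indicator (fun η => expChar l (S n η)) η ∂Q) atTop
          (𝓝 (∫⁻ _, 0 ∂Q)) := by
        refine tendsto_lintegral_of_dominated_convergence (fun _ => 1)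
          (fun n => ((measurable_expChar l).comp (hSm n)).indicator hAm.compl)
          (fun n => Eventually.of_forall fun η => ?_) (by simp)
          (Eventually.of_forall fun η => ?_)
        · exact (indicator_le_self _ _ _).trans (hexp_le l hl _)
        · by_cases hη : η ∈ A
          · simp [hη]
          · have h1 : Tendsto (fun n => ((S n η : ℝ≥0) : ℝ)) atTop atTop := by
              have h0 : ¬ Summable fun j => (η j : ℝ) := fun h => hη (NNReal.summable_coe.1 h)
              simpa [hS] using
                (not_summable_iff_tendsto_nat_atTop_of_nonneg fun j => (η j).2).1 h0
            simp only [indicator_of_mem (mem_compl hη), expChar]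
            rw [← ENNReal.ofReal_zero]
            exact (ENNReal.continuous_ofReal.tendsto _).comp
              (Real.tendsto_exp_neg_atTop_nhds_zero.comp (h1.const_mul_atTop hl))
      rw [lintegral_zero] at hlim
      have h2 : ∀ n, ∫⁻ η, expChar l (S n η) ∂Q
          ≤ Q A + ∫⁻ η, Aᶜ.indicator (fun η => expChar l (S n η)) η ∂Q := by
        intro n
        rw [lintegral_indicator hAm.compl,
          ← lintegral_add_compl (fun η => expChar l (S n η)) hAm]
        gcongr
        calc _ ≤ ∫⁻ _ in A, 1 ∂Q := lintegral_mono fun η => hexp_le l hl _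
          _ = Q A := by simp
      have h3 := le_of_tendsto_of_tendsto' (hLlim l hl) (tendsto_const_nhds.add hlim) h2
      simpa using h3
    have h1 : Tendsto (fun m : ℕ => ENNReal.ofReal (Real.exp (-(t * ψ (1 / ((m : ℝ) + 1))))))
        atTop (𝓝 1) := by
      have h2 := (ENNReal.continuous_ofReal.tendsto _).comp ((hψ0.const_mul t).neg.rexp)
      simpa using! h2
    have h3 : 1 ≤ Q A := le_of_tendsto' h1 fun m => hbound _ (by positivity)
    exact (prob_compl_eq_zero_iff hAm).2 (le_antisymm prob_le_one h3)
  set X : (ℕ → ℝ≥0) → ℝ := fun η => ((∑' j, η j : ℝ≥0) : ℝ) with hX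
  have hXm : Measurable X :=
    (Measurable.tsum fun j => measurable_pi_apply j).coe_nnreal_real
  refine ⟨Q.map X, Measure.isProbabilityMeasure_map hXm.aemeasurable, ?_, fun l hl => ?_⟩
  · rw [Measure.map_apply hXm measurableSet_Iio]
    have : X ⁻¹' Iio 0 = ∅ := by
      ext η
      simp [hX]
    rw [this, measure_empty]
  · have hc : Continuous fun s : ℝ => Real.exp (-(l * s)) := by fun_prop
    rw [integral_map hXm.aemeasurable hc.aestronglyMeasurable]
    have h1 : Tendsto (fun n => ∫ η, Real.exp (-(l * S n η)) ∂Q) atTop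
        (𝓝 (∫ η, Real.exp (-(l * X η)) ∂Q)) := by
      refine tendsto_integral_of_dominated_convergence (fun _ => 1)
        (fun n => (hc.measurable.comp (hSm n).coe_nnreal_real).aestronglyMeasurable)
        (integrable_const _) (fun n => Eventually.of_forall fun η => ?_) ?_
      · rw [Real.norm_of_nonneg (Real.exp_pos _).le]
        exact Real.exp_le_one_iff.2 (neg_nonpos.2 (mul_nonneg hl.le (S n η).2))
      · filter_upwards [hsum] with η hη
        exact (hc.tendsto _).comp (NNReal.tendsto_coe.2 hη.hasSum.tendsto_sum_nat)
    have h2 : ∀ n, ∫ η, Real.exp (-(l * S n η)) ∂Q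
        = (∫⁻ η, expChar l (S n η) ∂Q).toReal := fun n =>
      integral_eq_lintegral_of_nonneg_ae (Eventually.of_forall fun η => (Real.exp_pos _).le)
        (hc.measurable.comp (hSm n).coe_nnreal_real).aestronglyMeasurable
    simp_rw [h2] at h1
    refine tendsto_nhds_unique h1 ?_
    have h3 := (ENNReal.tendsto_toReal ENNReal.ofReal_ne_top).comp (hLlim l hl)
    rwa [ENNReal.toReal_ofReal (Real.exp_pos _).le] at h3

/-- `M^k` may be infinite, so it is cut into jump laws of mass one: each unit interval `(j, j+1]` is
pushed forward by the generalized inverse of `k`. -/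
theorem exists_isSubordinatorLaw {k : ℝ → ℝ} (hk : KernelCond k) {t : ℝ} (ht : 0 ≤ t) :
    ∃ μ, IsSubordinatorLaw k t μ := by
  set s : ℕ → Set ℝ := fun j => Ioc (j : ℝ) (j + 1) with hs
  have hsub : ∀ j, s j ⊆ Ioi 0 := fun j x hx => lt_of_le_of_lt (Nat.cast_nonneg j) hx.1
  have hU : ⋃ j, s j = Ioi 0 := by
    refine Subset.antisymm (iUnion_subset hsub) fun x hx => ?_
    have hx0 : (0 : ℝ) < x := hx
    have h1 : 0 < ⌈x⌉₊ := Nat.ceil_pos.2 hx0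
    refine mem_iUnion.2 ⟨⌈x⌉₊ - 1, ?_, ?_⟩
    · rw [← Nat.lt_ceil]
      omega
    · have h2 : ((⌈x⌉₊ - 1 : ℕ) : ℝ) + 1 = ⌈x⌉₊ := by
        rw [Nat.cast_sub h1]; simp
      rw [h2]
      exact Nat.le_ceil x
  have hdisj : Pairwise (Function.onFun Disjoint s) := by
    intro i j hij
    refine Set.disjoint_left.2 fun x hi hj => ?_
    have h1 : (i : ℝ) < j + 1 := hi.1.trans_le hj.2
    have h2 : (j : ℝ) < i + 1 := hj.1.trans_le hi.2
    norm_cast at h1 h2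
    omega
  have hgm : ∀ j, AEMeasurable (fun x => (tailInverse k x).toNNReal) (volume.restrict (s j)) :=
    fun j => ((aemeasurable_tailInverse hk).mono_measure
      (Measure.restrict_mono (hsub j) le_rfl)).real_toNNReal
  have htn : ∀ x, 0 ≤ tailInverse k x := fun x => Real.sInf_nonneg fun s hs => hs.1.le
  set ρ : ℕ → Measure ℝ≥0 := fun j =>
    (volume.restrict (s j)).map fun x => (tailInverse k x).toNNReal with hρ
  have hprob : ∀ j, IsProbabilityMeasure (ρ j) := fun j => by
    have : IsProbabilityMeasure (volume.restrict (s j)) := ⟨by simp [hs]⟩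
    exact Measure.isProbabilityMeasure_map (hgm j)
  suffices hψs : ∀ l : ℝ, 0 < l →
      HasSum (fun j => ∫ x, (1 - Real.exp (-(l * x))) ∂ρ j) (bernsteinFun k l) by
    obtain ⟨μ, h1, h2, h3⟩ := exists_law_of_hasSum ρ (bernsteinFun k) hψs
      (tendsto_bernsteinFun_zero hk) ht
    exact ⟨μ, h1, h2, h3⟩
  intro l hl
  have hc : Continuous fun τ : ℝ => 1 - Real.exp (-(τ * l)) := by fun_prop
  have hj : ∀ j, ∫ x : ℝ≥0, (1 - Real.exp (-(l * x))) ∂ρ j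
      = ∫ x in s j, (1 - Real.exp (-(tailInverse k x * l))) := by
    intro j
    rw [hρ, integral_map (hgm j)
      (by fun_prop : Continuous fun x : ℝ≥0 => 1 - Real.exp (-(l * x))).aestronglyMeasurable]
    refine integral_congr_ae (Eventually.of_forall fun x => ?_)
    simp only [Real.coe_toNNReal _ (htn x), mul_comm l]
  -- The generalized inverse may send a set of positive measure to `0`, which the restriction in
  -- `levyMeasure` discards; nothing is lost because the integrand vanishes at `0`.
  have hind : ∀ τ : ℝ, 0 ≤ τ → (Ioi (0 : ℝ)).indicator (fun τ => 1 - Real.exp (-(τ * l))) τ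
      = 1 - Real.exp (-(τ * l)) := by
    intro τ hτ
    rcases hτ.eq_or_lt with rfl | h
    · simp
    · rw [indicator_of_mem (mem_Ioi.2 h)]
  have hmp : AEStronglyMeasurable ((Ioi (0 : ℝ)).indicator fun τ => 1 - Real.exp (-(τ * l)))
      (Measure.map (tailInverse k) (volume.restrict (Ioi 0))) :=
    (hc.stronglyMeasurable.indicator measurableSet_Ioi).aestronglyMeasurable
  have hψ : bernsteinFun k l = ∫ x in ⋃ j, s j, (1 - Real.exp (-(tailInverse k x * l))) := by
    rw [hU, bernsteinFun, levyMeasure, ← integral_indicator measurableSet_Ioi,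
      integral_map (aemeasurable_tailInverse hk) hmp]
    exact integral_congr_ae (Eventually.of_forall fun x => hind _ (htn x))
  have hint : IntegrableOn (fun x => 1 - Real.exp (-(tailInverse k x * l))) (⋃ j, s j) := by
    have h := integrable_levyMeasure hk hl
    rw [levyMeasure] at h
    have h4 := (integrable_indicator_iff measurableSet_Ioi).2 h
    rw [integrable_map_measure hmp (aemeasurable_tailInverse hk)] at h4
    rw [hU]
    exact h4.congr (Eventually.of_forall fun x => hind _ (htn x))
  simp_rw [hj]
  rw [hψ]
  exact hasSum_integral_iUnion (fun j => measurableSet_Ioc) hdisj hint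

theorem isSubordinatorLaw_subordinatorLaw {k : ℝ → ℝ} (hk : KernelCond k) {t : ℝ} (ht : 0 ≤ t) :
    IsSubordinatorLaw k t (subordinatorLaw k t) :=
  Classical.epsilon_spec (exists_isSubordinatorLaw hk ht)

end Subordinator

/-! ### The relation `ĝ = -ψ v̂` and its time-domain form -/

section Relation

variable {E : Type*} [NormedAddCommGroup E] [NormedSpace ℝ E] {k : ℝ → ℝ}

/-- `v` and `g` are related by `ĝ = -ψ^k v̂`, on the level of Laplace transforms. -/
structure LapRel (k : ℝ → ℝ) (v g : ℝ → E) : Prop where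
  left : ExpIntegrable v
  right : ExpIntegrable g
  eq : ∀ l : ℝ, 0 < l → lap l g = -(bernsteinFun k l • lap l v)

lemma LapRel.sub {v w g h : ℝ → E} (h1 : LapRel k v g) (h2 : LapRel k w h) :
    LapRel k (fun t => v t - w t) (fun t => g t - h t) where
  left := h1.left.sub h2.left
  right := h1.right.sub h2.right
  eq l hl := by
    rw [lap_sub h1.right h2.right hl, lap_sub h1.left h2.left hl, h1.eq l hl, h2.eq l hl,
      smul_sub]
    abel

lemma LapRel.comp_clm [CompleteSpace E] {F : Type*} [NormedAddCommGroup F] [NormedSpace ℝ F]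
    [CompleteSpace F] (A : E →L[ℝ] F) {v g : ℝ → E} (h : LapRel k v g) :
    LapRel k (fun t => A (v t)) (fun t => A (g t)) where
  left := h.left.comp_clm A
  right := h.right.comp_clm A
  eq l hl := by
    rw [lap_comp_clm A h.left hl, lap_comp_clm A h.right hl, h.eq l hl, map_neg, map_smul]

lemma expIntegrable_one : ExpIntegrable (fun _ : ℝ => (1 : ℝ)) := fun l hl => by
  simpa using integrable_exp_neg_timeMeasure hl

lemma lap_one {l : ℝ} (hl : 0 < l) : lap l (fun _ : ℝ => (1 : ℝ)) = l⁻¹ := by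
  rw [lap, timeMeasure_eq]
  have := integral_exp_neg_mul_rpow (p := 1) (b := l) one_pos hl
  simp only [smul_eq_mul, mul_one]
  simpa [Real.rpow_neg hl.le, one_add_one_eq_two] using this

/-- The primitive of `v` that vanishes at `0`. -/
abbrev prim (v : ℝ → E) : ℝ → E := conv (fun _ => 1) v

lemma prim_eq (v : ℝ → E) (t : ℝ) : prim v t = ∫ s in Ioo 0 t, v s := by
  simp [prim, conv]

/-- The transform of `k * v + ∫₀^· g` is `k̂ v̂ + λ⁻¹ ĝ = k̂ v̂ - λ⁻¹ (λ k̂) v̂ = 0`. -/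
theorem LapRel.conv_eq [CompleteSpace E] (hk : KernelCond k) {v g : ℝ → E} (h : LapRel k v g) :
    conv k v =ᵐ[timeMeasure] fun t => -prim g t := by
  obtain ⟨h1, h2⟩ := lap_conv hk.expIntegrable h.left
  obtain ⟨h3, h4⟩ := lap_conv expIntegrable_one h.right
  have := ae_eq_zero_of_lap_eq_zero (h1.add h3) fun l hl => by
    rw [lap_add h1 h3 hl, h2 l hl, h4 l hl, h.eq l hl, lap_one hl, bernsteinFun_eq hk hl, smul_neg,
      smul_smul, inv_mul_cancel_left₀ hl.ne', add_neg_cancel]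
  filter_upwards [this] with t ht
  exact eq_neg_of_add_eq_zero_left ht

end Relation

/-! ### Exponential weights and Hölder bounds for the transform -/

section Exponential

variable {E : Type*} [NormedAddCommGroup E] [NormedSpace ℝ E]

lemma memLp_exp_neg {l : ℝ} (hl : 0 < l) {p : ℝ≥0∞} (hp : 1 ≤ p) :
    MemLp (fun t : ℝ => Real.exp (-(l * t))) p timeMeasure := by
  have hm := (integrable_exp_neg_timeMeasure hl).aestronglyMeasurable
  rcases eq_or_ne p ⊤ with rfl | hpt
  · refine memLp_top_of_bound hm 1 ?_
    filter_upwards [ae_restrict_mem measurableSet_Ici] with t ht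
    rw [Real.norm_of_nonneg (Real.exp_pos _).le]
    exact Real.exp_le_one_iff.2 (neg_nonpos.2 (mul_nonneg hl.le ht))
  · have hp0 : p ≠ 0 := (one_pos.trans_le hp).ne'
    rw [← integrable_norm_rpow_iff hm hp0 hpt]
    refine (integrable_exp_neg_timeMeasure
      (mul_pos hl (ENNReal.toReal_pos hp0 hpt))).congr (Eventually.of_forall fun t => ?_)
    simp only
    rw [Real.norm_of_nonneg (Real.exp_pos _).le, ← Real.exp_mul]
    ring_nf

lemma expIntegrable_of_memLp {p q : ℝ≥0∞} [ENNReal.HolderTriple p q 1] (hp : 1 ≤ p) {v : ℝ → E}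
    (hv : MemLp v q timeMeasure) : ExpIntegrable v := fun _ hl =>
  memLp_one_iff_integrable.1 (hv.smul (memLp_exp_neg hl hp))

lemma expIntegrable_of_integrable {v : ℝ → E} (hv : Integrable v timeMeasure) :
    ExpIntegrable v := fun _ hl => by
  have := memLp_exp_neg hl (p := ⊤) le_top
  exact memLp_one_iff_integrable.1 ((memLp_one_iff_integrable.2 hv).smul this)

lemma enorm_lap_le {l : ℝ} {v : ℝ → E} (hv : AEStronglyMeasurable v timeMeasure) :
    ‖lap l v‖ₑ ≤ eLpNorm (fun t : ℝ => Real.exp (-(l * t))) 2 timeMeasure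
      * eLpNorm v 2 timeMeasure := by
  refine (enorm_integral_le_lintegral_enorm _).trans ?_
  rw [← eLpNorm_one_eq_lintegral_enorm]
  exact eLpNorm_smul_le_mul_eLpNorm hv
    (by fun_prop : Continuous fun t : ℝ => Real.exp (-(l * t))).aestronglyMeasurable

end Exponential

/-! ### The subordinated semigroup: its transform, generator and coercivity -/

section Semigroup

variable {E : Type*} [NormedAddCommGroup E] [InnerProductSpace ℝ E] {k : ℝ → ℝ}

/-- Laplace transform of the subordinated shift; the last claim is the almost everywhere
existence of the integral that defines it. -/
theorem lap_subShift [CompleteSpace E] (hk : KernelCond k) {t : ℝ} (ht : 0 ≤ t) {v : ℝ → E}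
    (hv : ExpIntegrable v) :
    ExpIntegrable (subShift k t v) ∧
      (∀ l : ℝ, 0 < l → lap l (subShift k t v) = Real.exp (-(t * bernsteinFun k l)) • lap l v) ∧
      ∀ᵐ r, Integrable (fun s => shift s v r) (subordinatorLaw k t) := by
  have hμ := isSubordinatorLaw_subordinatorLaw hk ht
  set μ := subordinatorLaw k t with hμd
  have := hμ.prob
  have hsupp : ∀ᵐ s ∂μ, 0 ≤ s := by
    rw [ae_iff]
    simpa only [not_le] using! hμ.supp
  have key : ∀ l : ℝ, 0 < l →
      Integrable (fun r => Real.exp (-(l * r)) • subShift k t v r) timeMeasure ∧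
      lap l (subShift k t v) = Real.exp (-(t * bernsteinFun k l)) • lap l v ∧
      ∀ᵐ r, Integrable (fun s => shift s v r) μ := by
    intro l hl
    set W : ℝ → E := (Ici 0).indicator fun r => Real.exp (-(l * r)) • v r with hW
    have hWi : Integrable W := (integrable_indicator_iff measurableSet_Ici).2 (hv l hl)
    -- The integral of a non-integrable function is `0` by convention, while the transform is a
    -- positive number.
    have hf : Integrable (fun s => Real.exp (-(l * s))) μ :=
      Integrable.of_integral_ne_zero (by rw [hμ.laplace l hl]; exact (Real.exp_pos _).ne')
    set B : ℝ →L[ℝ] E →L[ℝ] E := ContinuousLinearMap.lsmul ℝ ℝ with hB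
    have hpt : ∀ r s, B (Real.exp (-(l * s))) (W (r - s))
        = Real.exp (-(l * r)) • shift s v r := by
      intro r s
      simp only [hB, ContinuousLinearMap.lsmul_apply, hW, shift]
      by_cases h : r - s ∈ Ici (0 : ℝ)
      · rw [indicator_of_mem h, indicator_of_mem h, smul_smul, ← Real.exp_add]
        ring_nf
      · rw [indicator_of_notMem h, indicator_of_notMem h, smul_zero, smul_zero]
    have hcv : convolution (fun s => Real.exp (-(l * s))) W B μ
        = (Ici 0).indicator fun r => Real.exp (-(l * r)) • subShift k t v r := by
      funext r
      rw [convolution]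
      simp_rw [hpt]
      by_cases hr : r ∈ Ici (0 : ℝ)
      · rw [indicator_of_mem hr, integral_smul]; rfl
      · rw [indicator_of_notMem hr]
        refine integral_eq_zero_of_ae ?_
        filter_upwards [hsupp] with s hs
        have : r - s ∉ Ici (0 : ℝ) := fun h => hr (by
          have : 0 ≤ r - s := h
          exact mem_Ici.2 (by linarith))
        simp [shift, this]
    have hprod := hf.convolution_integrand (μ := volume) B hWi
    have hval := integral_convolution (L := B) hf hWi
    have hint : Integrable (convolution (fun s => Real.exp (-(l * s))) W B μ) :=
      hprod.integral_prod_left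
    rw [hcv] at hint hval
    rw [integral_indicator measurableSet_Ici, hμ.laplace l hl, hW,
      integral_indicator measurableSet_Ici] at hval
    rw [integrable_indicator_iff measurableSet_Ici] at hint
    refine ⟨hint, hval, ?_⟩
    -- Fubini gives integrability of the weighted shifts for almost every `r`; the weight `e^{-lr}`
    -- is constant in `s` and can be removed.
    filter_upwards [hprod.prod_right_ae] with r hr
    simp only [hpt] at hr
    refine (hr.smul (Real.exp (l * r))).congr (Eventually.of_forall fun s => ?_)
    simp [smul_smul, ← Real.exp_add]
  exact ⟨fun l hl => (key l hl).1, fun l hl => (key l hl).2.1, (key 1 one_pos).2.2⟩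

lemma tendsto_exp_sub_one_div (a : ℝ) :
    Tendsto (fun t : ℝ => t⁻¹ * (Real.exp (-(t * a)) - 1)) (𝓝[>] 0) (𝓝 (-a)) := by
  have h1 : HasDerivAt (fun t : ℝ => Real.exp (-(t * a))) (-a) 0 := by
    have h2 : HasDerivAt (fun t : ℝ => -(t * a)) (-(1 * a)) 0 :=
      ((hasDerivAt_id (0 : ℝ)).mul_const a).neg
    refine h2.exp.congr_deriv ?_
    simp
  have h3 := h1.tendsto_slope_zero_right
  simpa using h3

/-- The transform at `l` is bounded on `L²`, so the transform of the residual tends to `0`. That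
same transform has an explicit limit, since `t⁻¹(e^{-tψ} - 1) → -ψ`. -/
theorem IsGenerator.lapRel [CompleteSpace E] (hk : KernelCond k) {v g : ℝ → E}
    (h : IsGenerator k v g) : LapRel k v g := by
  obtain ⟨hv, hg, hlim⟩ := h
  have hv' : ExpIntegrable v := expIntegrable_of_memLp (p := 2) one_le_two hv
  have hg' : ExpIntegrable g := expIntegrable_of_memLp (p := 2) one_le_two hg
  refine ⟨hv', hg', fun l hl => ?_⟩
  have hlap : ∀ t : ℝ, 0 < t →
      ExpIntegrable (fun r => t⁻¹ • (subShift k t v r - v r) - g r) ∧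
      lap l (fun r => t⁻¹ • (subShift k t v r - v r) - g r)
        = (t⁻¹ * (Real.exp (-(t * bernsteinFun k l)) - 1)) • lap l v - lap l g := by
    intro t ht
    obtain ⟨h1, h2, -⟩ := lap_subShift hk ht.le hv'
    have h3 : ExpIntegrable (fun r => t⁻¹ • (subShift k t v r - v r)) :=
      (h1.sub hv').comp_clm (t⁻¹ • ContinuousLinearMap.id ℝ E)
    refine ⟨h3.sub hg', ?_⟩
    rw [lap_sub h3 hg' hl]
    have h4 := lap_comp_clm (t⁻¹ • ContinuousLinearMap.id ℝ E) (h1.sub hv') hl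
    simp only [smul_apply, ContinuousLinearMap.id_apply] at h4
    rw [h4, lap_sub h1 hv' hl, h2 l hl, mul_smul, sub_smul, one_smul]
  have hlim1 : Tendsto (fun t : ℝ => (t⁻¹ * (Real.exp (-(t * bernsteinFun k l)) - 1)) • lap l v
      - lap l g) (𝓝[>] 0) (𝓝 (-(bernsteinFun k l) • lap l v - lap l g)) :=
    ((tendsto_exp_sub_one_div _).smul_const _).sub_const _
  have hlim2 : Tendsto (fun t : ℝ => (t⁻¹ * (Real.exp (-(t * bernsteinFun k l)) - 1)) • lap l v
      - lap l g) (𝓝[>] 0) (𝓝 0) := by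
    rw [tendsto_zero_iff_enorm_tendsto_zero]
    have h5 := ENNReal.Tendsto.const_mul hlim
      (Or.inr (memLp_exp_neg hl (p := 2) one_le_two).eLpNorm_ne_top)
    rw [mul_zero] at h5
    refine tendsto_of_tendsto_of_tendsto_of_le_of_le' tendsto_const_nhds h5
      (Eventually.of_forall fun _ => zero_le) ?_
    filter_upwards [self_mem_nhdsWithin] with t ht
    rw [← (hlap t ht).2]
    exact enorm_lap_le (hlap t ht).1.aestronglyMeasurable
  have h6 := tendsto_nhds_unique hlim1 hlim2
  rw [neg_smul] at h6
  exact (sub_eq_zero.1 h6).symm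

/-- Jensen's inequality for the probability measure `μ_t`. -/
lemma norm_subShift_sq_le [CompleteSpace E] (hk : KernelCond k) {t : ℝ} (ht : 0 ≤ t)
    {v : ℝ → E} (hv : MemLp v 2 timeMeasure) :
    ∀ᵐ r, ‖subShift k t v r‖ ^ 2 ≤ subShift k t (fun s => ‖v s‖ ^ 2) r := by
  have := (isSubordinatorLaw_subordinatorLaw hk ht).prob
  have hsq : Integrable (fun s => ‖v s‖ ^ 2) timeMeasure := hv.integrable_norm_pow two_ne_zero
  have h1 := (lap_subShift hk ht (expIntegrable_of_integrable hsq)).2.2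
  have h2 := (lap_subShift hk ht (expIntegrable_of_memLp (p := 2) one_le_two hv)).2.2
  filter_upwards [h1, h2] with r hr1 hr2
  have hpt : ∀ s, shift s (fun s => ‖v s‖ ^ 2) r = ‖shift s v r‖ ^ 2 := by
    intro s
    simp only [shift]
    by_cases h : r - s ∈ Ici (0 : ℝ)
    · rw [indicator_of_mem h, indicator_of_mem h]
    · rw [indicator_of_notMem h, indicator_of_notMem h]; simp
  simp only [hpt] at hr1
  simp only [subShift, hpt]
  set a := ‖∫ s, shift s v r ∂subordinatorLaw k t‖
  have ha : a ≤ ∫ s, ‖shift s v r‖ ∂subordinatorLaw k t := norm_integral_le_integral_norm _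
  -- Integrating `2ax ≤ a² + x²` over a probability measure, with `a ≤ ∫ x`, leaves `a² ≤ ∫ x²`.
  have h3 : ∫ s, 2 * a * ‖shift s v r‖ ∂subordinatorLaw k t
      ≤ ∫ s, (a ^ 2 + ‖shift s v r‖ ^ 2) ∂subordinatorLaw k t :=
    integral_mono (hr2.norm.const_mul _) ((integrable_const _).add hr1)
      fun s => by nlinarith [sq_nonneg (a - ‖shift s v r‖)]
  rw [integral_const_mul, integral_add (integrable_const _) hr1] at h3
  simp only [integral_const, probReal_univ, one_smul] at h3
  have ha0 : 0 ≤ a := norm_nonneg _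
  nlinarith [mul_le_mul_of_nonneg_left ha ha0]

lemma integrable_inner_mul_exp {γ : ℝ} (hγ : 0 < γ) {v w : ℝ → E} (hv : MemLp v 2 timeMeasure)
    (hw : MemLp w 2 timeMeasure) :
    Integrable (fun s => inner ℝ (v s) (w s) * Real.exp (-(γ * s))) timeMeasure := by
  have h1 : Integrable (fun s => inner ℝ (v s) (w s)) timeMeasure := by
    refine (hv.norm.integrable_mul hw.norm).mono'
      (hv.aestronglyMeasurable.inner hw.aestronglyMeasurable) (Eventually.of_forall fun s => ?_)
    exact norm_inner_le_norm _ _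
  simpa [mul_comm] using expIntegrable_of_integrable h1 γ hγ

/-- Coercivity of the generator in the exponentially weighted `L²` space. -/
theorem IsGenerator.le_neg_integral [CompleteSpace E] (hk : KernelCond k) {v g : ℝ → E}
    (h : IsGenerator k v g) {γ : ℝ} (hγ : 0 < γ) :
    1 / 2 * bernsteinFun k γ * ∫ s, ‖v s‖ ^ 2 * Real.exp (-(γ * s)) ∂timeMeasure
      ≤ -∫ s, inner ℝ (g s) (v s) * Real.exp (-(γ * s)) ∂timeMeasure := by
  obtain ⟨hv, hg, hlim⟩ := h
  have hsq : Integrable (fun s => ‖v s‖ ^ 2) timeMeasure := hv.integrable_norm_pow two_ne_zero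
  have hsqE := expIntegrable_of_integrable hsq
  set N := ∫ s, ‖v s‖ ^ 2 * Real.exp (-(γ * s)) ∂timeMeasure with hN
  have hNlap : lap γ (fun s => ‖v s‖ ^ 2) = N := by
    simp only [lap, hN, smul_eq_mul, mul_comm]
  set R : ℝ → ℝ → E := fun t r => t⁻¹ • (subShift k t v r - v r) - g r with hR
  have hmain : ∀ᶠ t : ℝ in 𝓝[>] 0,
      (∫ s, inner ℝ (R t s) (v s) * Real.exp (-(γ * s)) ∂timeMeasure)
        + ∫ s, inner ℝ (g s) (v s) * Real.exp (-(γ * s)) ∂timeMeasure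
      ≤ 1 / 2 * ((t⁻¹ * (Real.exp (-(t * bernsteinFun k γ)) - 1)) * N) := by
    filter_upwards [self_mem_nhdsWithin, hlim.eventually (gt_mem_nhds one_pos)] with t ht ht1
    have ht0 : (0 : ℝ) < t := ht
    have hvE : ExpIntegrable v := expIntegrable_of_memLp (p := 2) one_le_two hv
    have hUm : AEStronglyMeasurable (subShift k t v) timeMeasure :=
      (lap_subShift hk ht0.le hvE).1.aestronglyMeasurable
    -- Finiteness of the norm comes from the convergence itself: the residual norm is below `1` for
    -- small `t`.
    have hRm : MemLp (R t) 2 timeMeasure :=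
      ⟨((hUm.sub hv.1).const_smul t⁻¹).sub hg.1, ht1.trans ENNReal.one_lt_top⟩
    obtain ⟨h1, h2, -⟩ := lap_subShift hk ht0.le hsqE
    have h3 := h2 γ hγ
    rw [hNlap] at h3
    have hI1 := integrable_inner_mul_exp hγ hRm hv
    have hI2 := integrable_inner_mul_exp hγ hg hv
    have hle : ∫ s, (inner ℝ (R t s) (v s) * Real.exp (-(γ * s))
          + inner ℝ (g s) (v s) * Real.exp (-(γ * s))) ∂timeMeasure
        ≤ ∫ s, 1 / 2 * (t⁻¹ * (Real.exp (-(γ * s)) • subShift k t (fun s => ‖v s‖ ^ 2) s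
          - Real.exp (-(γ * s)) • ‖v s‖ ^ 2)) ∂timeMeasure := by
      refine integral_mono_ae (hI1.add hI2)
        ((((h1 γ hγ).sub (hsqE γ hγ)).const_mul _).const_mul _) ?_
      filter_upwards [ae_restrict_of_ae (norm_subShift_sq_le hk ht0.le hv)] with s hs
      have h4 : inner ℝ (R t s) (v s) + inner ℝ (g s) (v s)
          = t⁻¹ * (inner ℝ (subShift k t v s) (v s) - ‖v s‖ ^ 2) := by
        rw [← inner_add_left, hR]
        simp only [sub_add_cancel]
        rw [real_inner_smul_left, inner_sub_left, real_inner_self_eq_norm_sq]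
      -- Cauchy–Schwarz, then Young, then the Jensen bound `hs`.
      have h5 : inner ℝ (subShift k t v s) (v s)
          ≤ 1 / 2 * (subShift k t (fun s => ‖v s‖ ^ 2) s + ‖v s‖ ^ 2) := by
        have := real_inner_le_norm (subShift k t v s) (v s)
        nlinarith [sq_nonneg (‖subShift k t v s‖ - ‖v s‖)]
      rw [← add_mul, h4]
      have h6 : t⁻¹ * (inner ℝ (subShift k t v s) (v s) - ‖v s‖ ^ 2)
          ≤ t⁻¹ * (1 / 2 * (subShift k t (fun s => ‖v s‖ ^ 2) s - ‖v s‖ ^ 2)) :=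
        mul_le_mul_of_nonneg_left (by linarith) (inv_pos.2 ht0).le
      calc _ ≤ t⁻¹ * (1 / 2 * (subShift k t (fun s => ‖v s‖ ^ 2) s - ‖v s‖ ^ 2))
            * Real.exp (-(γ * s)) := mul_le_mul_of_nonneg_right h6 (Real.exp_pos _).le
        _ = _ := by simp only [smul_eq_mul]; ring
    rw [integral_add hI1 hI2, integral_const_mul, integral_const_mul,
      integral_sub (h1 γ hγ) (hsqE γ hγ)] at hle
    have h7 : ∫ s, Real.exp (-(γ * s)) • ‖v s‖ ^ 2 ∂timeMeasure = N := hNlap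
    rw [lap] at h3
    rw [h3, h7, smul_eq_mul] at hle
    refine hle.trans (le_of_eq ?_)
    ring
  have hR0 : Tendsto (fun t => ∫ s, inner ℝ (R t s) (v s) * Real.exp (-(γ * s)) ∂timeMeasure)
      (𝓝[>] 0) (𝓝 0) := by
    rw [tendsto_zero_iff_enorm_tendsto_zero]
    have h5 := ENNReal.Tendsto.mul_const hlim (Or.inr hv.eLpNorm_ne_top)
    rw [zero_mul] at h5
    refine tendsto_of_tendsto_of_tendsto_of_le_of_le' tendsto_const_nhds h5
      (Eventually.of_forall fun _ => zero_le) ?_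
    filter_upwards [self_mem_nhdsWithin] with t ht
    have ht0 : (0 : ℝ) < t := ht
    have hvE : ExpIntegrable v := expIntegrable_of_memLp (p := 2) one_le_two hv
    have hUm : AEStronglyMeasurable (subShift k t v) timeMeasure :=
      (lap_subShift hk ht0.le hvE).1.aestronglyMeasurable
    have hRm : AEStronglyMeasurable (R t) timeMeasure := ((hUm.sub hv.1).const_smul t⁻¹).sub hg.1
    refine (enorm_integral_le_lintegral_enorm _).trans ?_
    have h8 := eLpNorm_smul_le_mul_eLpNorm (p := 2) (q := 2) (r := 1) hv.1.norm hRm.norm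
    rw [eLpNorm_norm, eLpNorm_norm, eLpNorm_one_eq_lintegral_enorm] at h8
    refine le_trans (lintegral_mono_ae ?_) h8
    filter_upwards [ae_restrict_mem measurableSet_Ici] with s hs
    rw [enorm_le_iff_norm_le]
    simp only [Pi.smul_apply', norm_mul, smul_eq_mul, norm_norm]
    rw [Real.norm_of_nonneg (Real.exp_pos _).le]
    have h9 : Real.exp (-(γ * s)) ≤ 1 :=
      Real.exp_le_one_iff.2 (neg_nonpos.2 (mul_nonneg hγ.le hs))
    calc _ ≤ ‖inner ℝ (R t s) (v s)‖ * 1 := by gcongr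
      _ ≤ _ := by rw [mul_one]; exact norm_inner_le_norm _ _
  have hfin := le_of_tendsto_of_tendsto (hR0.add_const _)
    (((tendsto_exp_sub_one_div (bernsteinFun k γ)).mul_const N).const_mul (1 / 2)) hmain
  linarith

end Semigroup

/-! ### Hölder and Young-type inequalities -/

section Hoelder

variable {E F : Type*} [NormedAddCommGroup E] [NormedAddCommGroup F]

lemma lintegral_enorm_mul_enorm_le {X : Type*} [MeasurableSpace X] {m : Measure X} {p q : ℝ≥0∞}
    [ENNReal.HolderConjugate p q] {f : X → E} {g : X → F} (hf : AEStronglyMeasurable f m)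
    (hg : AEStronglyMeasurable g m) :
    ∫⁻ s, ‖f s‖ₑ * ‖g s‖ₑ ∂m ≤ eLpNorm f p m * eLpNorm g q m := by
  have h := eLpNorm_smul_le_mul_eLpNorm (p := p) (q := q) (r := 1) hg.norm hf.norm
  rw [eLpNorm_norm, eLpNorm_norm, eLpNorm_one_eq_lintegral_enorm] at h
  simpa [enorm_mul] using h

/-- A measurable majorant of `r ↦ ‖f(r)‖ (|κ| * ‖x‖)(r)`, with its integral estimated by the Hölder
inequality. -/
lemma exists_majorant_mul_conv {p q : ℝ≥0∞} [ENNReal.HolderConjugate p q] {f : ℝ → E} {x : ℝ → F}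
    {κ : ℝ → ℝ} (hf : AEStronglyMeasurable f timeMeasure)
    (hx : AEStronglyMeasurable x timeMeasure) (hκ : AEStronglyMeasurable κ timeMeasure) (T : ℝ) :
    ∃ Φ : ℝ → ℝ≥0∞, AEMeasurable Φ ∧
      (∀ r ∈ Ioo 0 T, ‖f r‖ₑ * ∫⁻ s in Ioo 0 r, ‖κ (r - s)‖ₑ * ‖x s‖ₑ ≤ Φ r) ∧
      ∫⁻ r, Φ r
        ≤ (∫⁻ τ in Ioo 0 T, ‖κ τ‖ₑ) * (eLpNorm f p timeMeasure * eLpNorm x q timeMeasure) := by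
  -- Extending by zero to the whole line makes translation invariance available; for `0 < s < r < T`
  -- only the values of `κ` on `(0,T)` enter.
  obtain ⟨f', hf'⟩ : ∃ f', f' = (Ici (0 : ℝ)).indicator f := ⟨_, rfl⟩
  obtain ⟨x', hx'⟩ : ∃ x', x' = (Ici (0 : ℝ)).indicator x := ⟨_, rfl⟩
  obtain ⟨κ', hκ'⟩ : ∃ κ', κ' = (Ioo (0 : ℝ) T).indicator κ := ⟨_, rfl⟩
  have hfm : AEStronglyMeasurable f' := by
    rw [hf']; exact (aestronglyMeasurable_indicator_iff measurableSet_Ici).2 hf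
  have hxm : AEStronglyMeasurable x' := by
    rw [hx']; exact (aestronglyMeasurable_indicator_iff measurableSet_Ici).2 hx
  have hκm : AEStronglyMeasurable κ' := by
    rw [hκ']
    exact (aestronglyMeasurable_indicator_iff measurableSet_Ioo).2
      (hκ.mono_measure (Measure.restrict_mono
        (Ioo_subset_Ioi_self.trans Ioi_subset_Ici_self) le_rfl))
  have hsubm : AEStronglyMeasurable (fun z : ℝ × ℝ => x' (z.1 - z.2)) (volume.prod volume) :=
    hxm.comp_quasiMeasurePreserving (quasiMeasurePreserving_sub_of_right_invariant _ _)
  have hmeas : AEMeasurable (fun z : ℝ × ℝ => ‖f' z.1‖ₑ * (‖κ' z.2‖ₑ * ‖x' (z.1 - z.2)‖ₑ))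
      (volume.prod volume) :=
    hfm.comp_fst.enorm.mul (hκm.comp_snd.enorm.mul hsubm.enorm)
  refine ⟨fun r => ∫⁻ τ, ‖f' r‖ₑ * (‖κ' τ‖ₑ * ‖x' (r - τ)‖ₑ), hmeas.lintegral_prod_right',
    fun r hr => ?_, ?_⟩
  · simp only
    rw [lintegral_const_mul' _ _ enorm_ne_top]
    refine mul_le_mul' ?_ ?_
    · rw [hf', indicator_of_mem (mem_Ici.2 hr.1.le)]
    · rw [← lintegral_sub_left_eq_self (fun τ => ‖κ' τ‖ₑ * ‖x' (r - τ)‖ₑ) r,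
        ← lintegral_indicator measurableSet_Ioo]
      refine lintegral_mono fun s => ?_
      by_cases hs : s ∈ Ioo 0 r
      · have h2 : r - s ∈ Ioo 0 T := ⟨sub_pos.2 hs.2, by linarith [hs.1, hr.2]⟩
        rw [indicator_of_mem hs, sub_sub_cancel, hκ', hx', indicator_of_mem h2,
          indicator_of_mem (mem_Ici.2 hs.1.le)]
      · rw [indicator_of_notMem hs]
        exact zero_le
  rw [lintegral_lintegral_swap hmeas]
  -- For fixed `τ` this is Hölder, with the norm of the translate equal to that of `x'`; integrating
  -- in `τ` then produces the `L¹` norm of the kernel.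
  have h3 : ∀ τ, ∫⁻ r, ‖f' r‖ₑ * (‖κ' τ‖ₑ * ‖x' (r - τ)‖ₑ)
      ≤ ‖κ' τ‖ₑ * (eLpNorm f p timeMeasure * eLpNorm x q timeMeasure) := by
    intro τ
    have hmp : MeasurePreserving (fun r : ℝ => r - τ) volume volume :=
      measurePreserving_sub_right volume τ
    have hm : AEStronglyMeasurable (fun r => x' (r - τ)) :=
      hxm.comp_quasiMeasurePreserving hmp.quasiMeasurePreserving
    have h4 := lintegral_enorm_mul_enorm_le (p := p) (q := q) hfm hm
    have h5 := eLpNorm_comp_measurePreserving (p := q) hxm hmp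
    rw [Function.comp_def] at h5
    rw [h5, hf', hx', eLpNorm_indicator_eq_eLpNorm_restrict measurableSet_Ici,
      eLpNorm_indicator_eq_eLpNorm_restrict measurableSet_Ici, ← hf', ← hx'] at h4
    calc _ = ∫⁻ r, ‖κ' τ‖ₑ * (‖f' r‖ₑ * ‖x' (r - τ)‖ₑ) :=
          lintegral_congr fun r => mul_left_comm _ _ _
      _ = ‖κ' τ‖ₑ * ∫⁻ r, ‖f' r‖ₑ * ‖x' (r - τ)‖ₑ := lintegral_const_mul' _ _ enorm_ne_top
      _ ≤ _ := mul_le_mul' le_rfl h4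
  refine (lintegral_mono h3).trans ?_
  rw [lintegral_mul_const'' _ hκm.enorm]
  refine mul_le_mul' (le_of_eq ?_) le_rfl
  rw [← lintegral_indicator measurableSet_Ioo]
  refine lintegral_congr fun τ => ?_
  rw [hκ', enorm_indicator_eq_indicator_enorm]

lemma enorm_add_le_of_normed (x y : E) : ‖x + y‖ₑ ≤ ‖x‖ₑ + ‖y‖ₑ := enorm_add_le x y

lemma eLpNorm_fun_sub_le {X : Type*} [MeasurableSpace X] {m : Measure X} {p : ℝ≥0∞} (hp : 1 ≤ p)
    {f g : X → E} (hf : AEStronglyMeasurable f m) (hg : AEStronglyMeasurable g m) :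
    eLpNorm (fun s => f s - g s) p m ≤ eLpNorm f p m + eLpNorm g p m := eLpNorm_sub_le hf hg hp

lemma memLp_zero_fun {X : Type*} [MeasurableSpace X] {m : Measure X} {p : ℝ≥0∞} :
    MemLp (fun _ : X => (0 : E)) p m := MemLp.zero

lemma eLpNorm_zero_fun {X : Type*} [MeasurableSpace X] {m : Measure X} {p : ℝ≥0∞} :
    eLpNorm (fun _ : X => (0 : E)) p m = 0 := eLpNorm_zero

lemma enorm_inner_le {H : Type*} [NormedAddCommGroup H] [InnerProductSpace ℝ H] (x y : H) :
    ‖inner ℝ x y‖ₑ ≤ ‖x‖ₑ * ‖y‖ₑ := by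
  rw [← enorm_norm x, ← enorm_norm y, ← enorm_mul, enorm_le_iff_norm_le, norm_mul, norm_norm,
    norm_norm]
  exact norm_inner_le_norm x y

end Hoelder

/-! ### The Gelfand triple and the duality of the path spaces -/

section Triple

variable {H : Type*} [NormedAddCommGroup H] [InnerProductSpace ℝ H]
  {V : Type*} [NormedAddCommGroup V] [NormedSpace ℝ V] {ι : V →L[ℝ] H} {α : ℝ}

/-- The embedding `H → V*` as a continuous linear map. -/
def toDualL (ι : V →L[ℝ] H) : H →L[ℝ] StrongDual ℝ V :=
  LinearMap.mkContinuous
    { toFun := toDual ι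
      map_add' := fun x y => by ext v; simp [toDual]
      map_smul' := fun c x => by ext v; simp [toDual] } ‖ι‖ fun h => by
    refine ContinuousLinearMap.opNorm_le_bound _ (by positivity) fun v => ?_
    calc _ ≤ ‖h‖ * ‖ι v‖ := norm_inner_le_norm h (ι v)
      _ ≤ ‖h‖ * (‖ι‖ * ‖v‖) := by gcongr; exact ι.le_opNorm v
      _ = _ := by ring

@[simp] lemma toDualL_apply (h : H) : toDualL ι h = toDual ι h := rfl

lemma toDual_apply (h : H) (v : V) : toDual ι h v = inner ℝ h (ι v) := rfl

lemma toDual_sub (g h : H) : toDual ι (g - h) = toDual ι g - toDual ι h :=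
  (toDualL ι).map_sub g h

lemma toDual_injective (hdense : DenseRange ι) : Function.Injective (toDual ι) := by
  intro g h hgh
  rw [← sub_eq_zero, ← inner_self_eq_zero (𝕜 := ℝ)]
  have h1 : (fun y => inner ℝ (g - h) y) = fun _ : H => (0 : ℝ) := by
    refine hdense.equalizer (by fun_prop) continuous_const (funext fun v => ?_)
    have h2 := congrArg (fun f : StrongDual ℝ V => f v) hgh
    simp only [toDual_apply] at h2
    simp [inner_sub_left, h2]
  exact congrFun h1 (g - h)

lemma holderConjugate_of_one_lt (hα : 1 < α) :
    ENNReal.HolderConjugate (ENNReal.ofReal (α / (α - 1))) (ENNReal.ofReal α) :=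
  (Real.HolderConjugate.conjExponent hα).symm.ennrealOfReal

lemma one_le_ofReal (hα : 1 < α) : 1 ≤ ENNReal.ofReal α := ENNReal.one_le_ofReal.2 hα.le

lemma IsDecomp.sub {f g f₁ g₁ : ℝ → StrongDual ℝ V} {f₂ g₂ : ℝ → H} (hf : IsDecomp ι α f f₁ f₂)
    (hg : IsDecomp ι α g g₁ g₂) :
    IsDecomp ι α (fun s => f s - g s) (fun s => f₁ s - g₁ s) (fun s => f₂ s - g₂ s) := by
  refine ⟨hf.1.sub hg.1, hf.2.1.sub hg.2.1, ?_⟩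
  filter_upwards [hf.2.2, hg.2.2] with s h1 h2
  rw [h1, h2, toDual_sub]
  abel

lemma MemVDual.sub {f g : ℝ → StrongDual ℝ V} (hf : MemVDual ι α f) (hg : MemVDual ι α g) :
    MemVDual ι α (fun s => f s - g s) := by
  obtain ⟨f₁, f₂, h1⟩ := hf
  obtain ⟨g₁, g₂, h2⟩ := hg
  exact ⟨_, _, h1.sub h2⟩

lemma memVDual_toDual {g : ℝ → H} (hg : MemLp g 2 timeMeasure) :
    MemVDual ι α (fun s => toDual ι (g s)) :=
  ⟨fun _ => 0, g, memLp_zero_fun, hg, Eventually.of_forall fun _ => (zero_add _).symm⟩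

lemma normVDual_le {f f₁ : ℝ → StrongDual ℝ V} {f₂ : ℝ → H} (h : IsDecomp ι α f f₁ f₂) :
    normVDual ι α f
      ≤ eLpNorm f₁ (ENNReal.ofReal (α / (α - 1))) timeMeasure + eLpNorm f₂ 2 timeMeasure :=
  iInf_le_of_le f₁ (iInf_le_of_le f₂ (iInf_le _ h))

lemma normVDual_sub_le (hα : 1 < α) (f g : ℝ → StrongDual ℝ V) :
    normVDual ι α (fun s => f s - g s) ≤ normVDual ι α f + normVDual ι α g := by
  have hp : 1 ≤ ENNReal.ofReal (α / (α - 1)) :=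
    ENNReal.one_le_ofReal.2 (Real.HolderConjugate.conjExponent hα).symm.lt.le
  rw [← tsub_le_iff_right]
  refine le_iInf fun f₁ => le_iInf fun f₂ => le_iInf fun h1 => ?_
  rw [tsub_le_iff_right, ← tsub_le_iff_left]
  refine le_iInf fun g₁ => le_iInf fun g₂ => le_iInf fun h2 => ?_
  rw [tsub_le_iff_left]
  have h3 := eLpNorm_fun_sub_le hp h1.1.1 h2.1.1
  have h4 := eLpNorm_fun_sub_le one_le_two h1.2.1.1 h2.2.1.1
  refine (normVDual_le (h1.sub h2)).trans ((add_le_add h3 h4).trans (le_of_eq ?_))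
  exact add_add_add_comm _ _ _ _

/-- The device by which an estimate valid for every decomposition passes to the infimum. Dividing by
`C` requires `C ≠ 0`; if `C = 0`, one existing decomposition suffices. -/
lemma le_mul_normVDual {f : ℝ → StrongDual ℝ V} (hf : MemVDual ι α f) {c C : ℝ≥0∞} (hC : C ≠ ⊤)
    (h : ∀ f₁ f₂, IsDecomp ι α f f₁ f₂ → c ≤ C *
      (eLpNorm f₁ (ENNReal.ofReal (α / (α - 1))) timeMeasure + eLpNorm f₂ 2 timeMeasure)) :
    c ≤ C * normVDual ι α f := by
  rcases eq_or_ne C 0 with rfl | hC0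
  · obtain ⟨f₁, f₂, h1⟩ := hf
    simpa using h f₁ f₂ h1
  · rw [← ENNReal.div_le_iff' hC0 hC]
    exact le_iInf fun f₁ => le_iInf fun f₂ => le_iInf fun h1 =>
      (ENNReal.div_le_iff' hC0 hC).2 (h f₁ f₂ h1)

lemma normVDual_lt_top {f : ℝ → StrongDual ℝ V} (hf : MemVDual ι α f) : normVDual ι α f < ⊤ := by
  obtain ⟨f₁, f₂, h⟩ := hf
  exact (normVDual_le h).trans_lt (ENNReal.add_lt_top.2 ⟨h.1.2, h.2.1.2⟩)

lemma normV_lt_top {u : ℝ → V} (hu : MemV ι α u) : normV ι α u < ⊤ := max_lt hu.1.2 hu.2.2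

lemma MemV.sub {u v : ℝ → V} (hu : MemV ι α u) (hv : MemV ι α v) :
    MemV ι α (fun s => u s - v s) :=
  ⟨hu.1.sub hv.1, by simpa only [map_sub] using! hu.2.sub hv.2⟩

lemma normV_sub_le (hα : 1 < α) {u v : ℝ → V} (hu : MemV ι α u) (hv : MemV ι α v) :
    normV ι α (fun s => u s - v s) ≤ normV ι α u + normV ι α v := by
  refine max_le ?_ ?_
  · exact (eLpNorm_fun_sub_le (one_le_ofReal hα) hu.1.1 hv.1.1).trans
      (add_le_add (le_max_left _ _) (le_max_left _ _))
  · simp only [map_sub]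
    exact (eLpNorm_fun_sub_le one_le_two hu.2.1 hv.2.1).trans
      (add_le_add (le_max_right _ _) (le_max_right _ _))

lemma MemVDual.expIntegrable (hα : 1 < α) {f : ℝ → StrongDual ℝ V} (hf : MemVDual ι α f) :
    ExpIntegrable f := by
  obtain ⟨f₁, f₂, h1, h2, h3⟩ := hf
  have := (holderConjugate_of_one_lt hα).symm
  have h4 : ExpIntegrable f₁ := expIntegrable_of_memLp (one_le_ofReal hα) h1
  have h5 : ExpIntegrable f₂ := expIntegrable_of_memLp (p := 2) one_le_two h2
  intro l hl
  refine ((h4.add (h5.comp_clm (toDualL ι))) l hl).congr ?_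
  filter_upwards [h3] with s hs
  rw [hs, toDualL_apply]

/-- `𝓥*` is continuously embedded in weighted `L¹([0,∞); V*)` spaces. -/
lemma lintegral_enorm_mul_enorm_le_normVDual (hα : 1 < α) {f : ℝ → StrongDual ℝ V}
    (hf : MemVDual ι α f) {a : ℝ → ℝ} (ha1 : MemLp a (ENNReal.ofReal α) timeMeasure)
    (ha2 : MemLp a 2 timeMeasure) :
    ∫⁻ s, ‖a s‖ₑ * ‖f s‖ₑ ∂timeMeasure
      ≤ (eLpNorm a (ENNReal.ofReal α) timeMeasure + ‖toDualL ι‖ₑ * eLpNorm a 2 timeMeasure)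
        * normVDual ι α f := by
  have := (holderConjugate_of_one_lt hα).symm
  refine le_mul_normVDual hf (ENNReal.add_ne_top.2
    ⟨ha1.2.ne, ENNReal.mul_ne_top enorm_ne_top ha2.2.ne⟩) fun f₁ f₂ h => ?_
  have h1 := lintegral_enorm_mul_enorm_le (p := ENNReal.ofReal α)
    (q := ENNReal.ofReal (α / (α - 1))) ha1.1 h.1.1
  have h2 := lintegral_enorm_mul_enorm_le (p := 2) (q := 2) ha2.1 h.2.1.1
  calc ∫⁻ s, ‖a s‖ₑ * ‖f s‖ₑ ∂timeMeasure
      ≤ ∫⁻ s, (‖a s‖ₑ * ‖f₁ s‖ₑ + ‖toDualL ι‖ₑ * (‖a s‖ₑ * ‖f₂ s‖ₑ)) ∂timeMeasure := by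
        refine lintegral_mono_ae ?_
        filter_upwards [h.2.2] with s hs
        rw [hs, mul_left_comm, ← mul_add]
        have h3 : ‖f₁ s + toDual ι (f₂ s)‖ₑ ≤ ‖f₁ s‖ₑ + ‖toDual ι (f₂ s)‖ₑ :=
          enorm_add_le_of_normed _ _
        exact mul_le_mul' le_rfl
          (h3.trans (add_le_add le_rfl ((toDualL ι).le_opENorm (f₂ s))))
    _ = ∫⁻ s, ‖a s‖ₑ * ‖f₁ s‖ₑ ∂timeMeasure
        + ‖toDualL ι‖ₑ * ∫⁻ s, ‖a s‖ₑ * ‖f₂ s‖ₑ ∂timeMeasure := by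
        rw [← lintegral_const_mul' _ _ enorm_ne_top]
        exact lintegral_add_left' (ha1.1.enorm.mul h.1.1.enorm) _
    _ ≤ _ := add_le_add h1 (mul_le_mul' le_rfl h2)
    _ ≤ _ := by
        rw [add_mul, mul_add, mul_add, ← mul_assoc]
        exact add_le_add le_self_add le_add_self

/-- The duality between `𝓥` and `𝓥*`. -/
lemma lintegral_enorm_pairing_le (hα : 1 < α) {f : ℝ → StrongDual ℝ V} (hf : MemVDual ι α f)
    {u : ℝ → V} (hu : MemV ι α u) :
    ∫⁻ s, ‖f s (u s)‖ₑ ∂timeMeasure ≤ normV ι α u * normVDual ι α f := by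
  have := holderConjugate_of_one_lt hα
  refine le_mul_normVDual hf (normV_lt_top hu).ne fun f₁ f₂ h => ?_
  have h1 := lintegral_enorm_mul_enorm_le (p := ENNReal.ofReal (α / (α - 1)))
    (q := ENNReal.ofReal α) h.1.1 hu.1.1
  have h2 := lintegral_enorm_mul_enorm_le (p := 2) (q := 2) h.2.1.1 hu.2.1
  calc ∫⁻ s, ‖f s (u s)‖ₑ ∂timeMeasure
      ≤ ∫⁻ s, (‖f₁ s‖ₑ * ‖u s‖ₑ + ‖f₂ s‖ₑ * ‖ι (u s)‖ₑ) ∂timeMeasure := by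
        refine lintegral_mono_ae ?_
        filter_upwards [h.2.2] with s hs
        rw [hs, add_apply]
        exact (enorm_add_le _ _).trans
          (add_le_add ((f₁ s).le_opENorm _) (enorm_inner_le _ _))
    _ = ∫⁻ s, ‖f₁ s‖ₑ * ‖u s‖ₑ ∂timeMeasure + ∫⁻ s, ‖f₂ s‖ₑ * ‖ι (u s)‖ₑ ∂timeMeasure :=
        lintegral_add_left' (h.1.1.enorm.mul hu.1.1.enorm) _
    _ ≤ _ := add_le_add h1 h2
    _ ≤ _ := by
        rw [mul_add, mul_comm (normV ι α u), mul_comm (normV ι α u)]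
        exact add_le_add (mul_le_mul' le_rfl (le_max_left _ _))
          (mul_le_mul' le_rfl (le_max_right _ _))

/-- The duality between a function and the convolution of another one with a kernel. -/
lemma lintegral_enorm_inner_conv_le [CompleteSpace H] (hα : 1 < α) {κ : ℝ → ℝ} (hκ : ExpIntegrable κ) {g : ℝ → H}
    (hg : MemLp g 2 timeMeasure) {u : ℝ → V} (hu : MemV ι α u) (T : ℝ) :
    ∫⁻ r in Ioo 0 T, ‖inner ℝ (g r) (conv κ (fun s => ι (u s)) r)‖ₑ
      ≤ (∫⁻ τ in Ioo 0 T, ‖κ τ‖ₑ) * normV ι α u * normVDual ι α (fun s => toDual ι (g s)) := by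
  have := holderConjugate_of_one_lt hα
  have hsub : Ioo 0 T ⊆ Ici (0 : ℝ) := Ioo_subset_Ioi_self.trans Ioi_subset_Ici_self
  have hκT : ∫⁻ τ in Ioo 0 T, ‖κ τ‖ₑ < ⊤ :=
    ((hκ.integrableOn T).mono_set Ioo_subset_Icc_self).2
  refine le_mul_normVDual (memVDual_toDual hg)
    (ENNReal.mul_ne_top hκT.ne (normV_lt_top hu).ne) fun f₁ f₂ h => ?_
  have hκm := hκ.aestronglyMeasurable
  obtain ⟨Φ₁, hm1, hle1, hi1⟩ := exists_majorant_mul_conv (p := ENNReal.ofReal (α / (α - 1)))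
    (q := ENNReal.ofReal α) h.1.1 hu.1.1 hκm T
  obtain ⟨Φ₂, hm2, hle2, hi2⟩ := exists_majorant_mul_conv (p := 2) (q := 2) h.2.1.1 hu.2.1 hκm T
  have hκr : ∀ r : ℝ, AEMeasurable (fun s => ‖κ (r - s)‖ₑ) (volume.restrict (Ioo 0 r)) := by
    intro r
    have hmp : MeasurePreserving (fun s : ℝ => r - s) volume volume :=
      volume.measurePreserving_sub_left r
    have hi : AEStronglyMeasurable ((Ici 0).indicator κ) :=
      (aestronglyMeasurable_indicator_iff measurableSet_Ici).2 hκm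
    have h3 : AEStronglyMeasurable (fun s => (Ici (0 : ℝ)).indicator κ (r - s)) :=
      hi.comp_quasiMeasurePreserving hmp.quasiMeasurePreserving
    refine (h3.restrict (s := Ioo 0 r)).enorm.congr ?_
    filter_upwards [ae_restrict_mem measurableSet_Ioo] with s hs
    rw [indicator_of_mem (mem_Ici.2 (sub_pos.2 hs.2).le)]
  have hur : ∀ r : ℝ, AEMeasurable (fun s => ‖u s‖ₑ) (volume.restrict (Ioo 0 r)) := fun r =>
    (hu.1.1.mono_measure (Measure.restrict_mono
      (Ioo_subset_Ioi_self.trans Ioi_subset_Ici_self) le_rfl)).enorm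
  have hpt : ∀ᵐ r ∂volume.restrict (Ioo 0 T), ‖inner ℝ (g r) (conv κ (fun s => ι (u s)) r)‖ₑ
      ≤ Φ₁ r + Φ₂ r := by
    filter_upwards [ae_restrict_of_ae_restrict_of_subset hsub h.2.2,
      ae_restrict_mem measurableSet_Ioo] with r hr hrT
    -- Where the defining integral diverges, the convolution is `0` by convention and the bound is
    -- trivial.
    by_cases hi : Integrable (fun s => κ (r - s) • ι (u s)) (volume.restrict (Ioo 0 r))
    · rw [conv, ← integral_inner hi]
      refine (enorm_integral_le_lintegral_enorm _).trans
        (le_trans ?_ (add_le_add (hle1 r hrT) (hle2 r hrT)))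
      rw [← lintegral_const_mul' _ _ enorm_ne_top, ← lintegral_const_mul' _ _ enorm_ne_top]
      have hm : AEMeasurable (fun s => ‖f₁ r‖ₑ * (‖κ (r - s)‖ₑ * ‖u s‖ₑ))
          (volume.restrict (Ioo 0 r)) := ((hκr r).mul (hur r)).const_mul _
      rw [← lintegral_add_left' hm]
      refine lintegral_mono fun s => ?_
      -- The decomposition is inserted under the integral, because `f₁ r` acts on `V` and cannot be
      -- applied to the `H`-valued convolution.
      have h4 : inner ℝ (g r) (κ (r - s) • ι (u s))
          = κ (r - s) * (f₁ r (u s) + inner ℝ (f₂ r) (ι (u s))) := by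
        rw [real_inner_smul_right, ← toDual_apply, hr]
        rfl
      rw [h4, enorm_mul, mul_left_comm, mul_left_comm ‖f₂ r‖ₑ, ← mul_add]
      exact mul_le_mul' le_rfl ((enorm_add_le _ _).trans
        (add_le_add ((f₁ r).le_opENorm _) (enorm_inner_le _ _)))
    · rw [conv, integral_undef hi, inner_zero_right, enorm_zero]
      exact zero_le
  calc _ ≤ ∫⁻ r in Ioo 0 T, (Φ₁ r + Φ₂ r) := lintegral_mono_ae hpt
    _ ≤ ∫⁻ r, (Φ₁ r + Φ₂ r) := setLIntegral_le_lintegral _ _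
    _ = (∫⁻ r, Φ₁ r) + ∫⁻ r, Φ₂ r := lintegral_add_left' hm1 _
    _ ≤ _ := add_le_add hi1 hi2
    _ ≤ _ := by
      rw [← mul_add, mul_assoc, mul_add (normV ι α u), mul_comm (normV ι α u),
        mul_comm (normV ι α u)]
      exact mul_le_mul' le_rfl (add_le_add (mul_le_mul' le_rfl (le_max_left _ _))
        (mul_le_mul' le_rfl (le_max_right _ _)))

end Triple

/-! ### Passage of the transform relation to the closure -/

section Closure

variable {H : Type*} [NormedAddCommGroup H] [InnerProductSpace ℝ H] 
  {V : Type*} [NormedAddCommGroup V] [NormedSpace ℝ V] {ι : V →L[ℝ] H} {α : ℝ} {k : ℝ → ℝ}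

lemma enorm_smul_sub_smul {E : Type*} [NormedAddCommGroup E] [NormedSpace ℝ E] (c : ℝ) (x y : E) :
    ‖c • x - c • y‖ₑ = ‖c‖ₑ * ‖x - y‖ₑ := by
  rw [← smul_sub, enorm_smul]

lemma MemV.expIntegrable {u : ℝ → V} (hu : MemV ι α u) : ExpIntegrable (fun s => ι (u s)) :=
  expIntegrable_of_memLp (p := 2) one_le_two hu.2

/-- Elements of `𝓥*` that converge to zero have integrals converging to zero. -/
lemma tendsto_integral_smul_of_normVDual (hα : 1 < α) {F : ℕ → ℝ → StrongDual ℝ V}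
    {f : ℝ → StrongDual ℝ V} (hF : ∀ n, MemVDual ι α (F n)) (hf : MemVDual ι α f)
    (hlim : Tendsto (fun n => normVDual ι α (fun s => F n s - f s)) atTop (𝓝 0)) {a : ℝ → ℝ}
    (ha1 : MemLp a (ENNReal.ofReal α) timeMeasure) (ha2 : MemLp a 2 timeMeasure) :
    Tendsto (fun n => ∫ s, a s • F n s ∂timeMeasure) atTop (𝓝 (∫ s, a s • f s ∂timeMeasure)) := by
  have hmeas : ∀ {f : ℝ → StrongDual ℝ V}, MemVDual ι α f →
      AEStronglyMeasurable (fun s => a s • f s) timeMeasure := fun hf =>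
    ha1.1.smul (hf.expIntegrable hα).aestronglyMeasurable
  have hint : ∀ {f : ℝ → StrongDual ℝ V}, MemVDual ι α f →
      Integrable (fun s => a s • f s) timeMeasure := fun hf => by
    refine ⟨hmeas hf, ?_⟩
    simp only [HasFiniteIntegral, enorm_smul]
    refine (lintegral_enorm_mul_enorm_le_normVDual hα hf ha1 ha2).trans_lt ?_
    exact ENNReal.mul_lt_top (ENNReal.add_lt_top.2
      ⟨ha1.2, ENNReal.mul_lt_top enorm_lt_top ha2.2⟩) (normVDual_lt_top hf)
  refine tendsto_integral_of_L1 _ (hmeas hf) (Eventually.of_forall fun n => hint (hF n)) ?_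
  have h1 := ENNReal.Tendsto.const_mul hlim (Or.inr (ENNReal.add_ne_top.2
      ⟨ha1.2.ne, ENNReal.mul_ne_top (enorm_ne_top (x := toDualL ι)) ha2.2.ne⟩))
  rw [mul_zero] at h1
  refine tendsto_of_tendsto_of_tendsto_of_le_of_le tendsto_const_nhds h1
    (fun _ => zero_le) fun n => ?_
  refine le_trans (lintegral_mono fun s => (enorm_smul_sub_smul _ _ _).le) ?_
  exact lintegral_enorm_mul_enorm_le_normVDual hα ((hF n).sub hf) ha1 ha2

lemma tendsto_lap_of_memLp {F : ℕ → ℝ → H} {f : ℝ → H} (hF : ∀ n, MemLp (F n) 2 timeMeasure)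
    (hf : MemLp f 2 timeMeasure)
    (hlim : Tendsto (fun n => eLpNorm (fun s => F n s - f s) 2 timeMeasure) atTop (𝓝 0))
    {l : ℝ} (hl : 0 < l) : Tendsto (fun n => lap l (F n)) atTop (𝓝 (lap l f)) := by
  have hE : ∀ {f : ℝ → H}, MemLp f 2 timeMeasure → ExpIntegrable f :=
    fun hf => expIntegrable_of_memLp (p := 2) one_le_two hf
  rw [tendsto_iff_edist_tendsto_0]
  have h1 := ENNReal.Tendsto.const_mul hlim
    (Or.inr (memLp_exp_neg hl (p := 2) one_le_two).2.ne)
  rw [mul_zero] at h1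
  refine tendsto_of_tendsto_of_tendsto_of_le_of_le tendsto_const_nhds h1
    (fun _ => zero_le) fun n => ?_
  simp only [edist_eq_enorm_sub]
  rw [← lap_sub (hE (hF n)) (hE hf) hl]
  exact enorm_lap_le ((hF n).1.sub hf.1)

/-- The Laplace transform relation passes to the closure of the graph. -/
theorem ClosureGraph.lapRel [CompleteSpace H] (hα : 1 < α) (hk : KernelCond k) {u : ℝ → V}
    {f : ℝ → StrongDual ℝ V} (h : ClosureGraph ι α k u f) :
    LapRel k (fun s => toDual ι (ι (u s))) f := by
  obtain ⟨hu, hf, un, gn, hn, hun, hgn⟩ := h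
  refine ⟨hu.expIntegrable.comp_clm (toDualL ι), hf.expIntegrable hα, fun l hl => ?_⟩
  have hrel : ∀ n, LapRel k (fun s => toDual ι (ι (un n s))) (fun s => toDual ι (gn n s)) :=
    fun n => ((hn n).2.lapRel hk).comp_clm (toDualL ι)
  have h1 : Tendsto (fun n => lap l (fun s => toDual ι (gn n s))) atTop (𝓝 (lap l f)) :=
    tendsto_integral_smul_of_normVDual hα (fun n => memVDual_toDual (hn n).2.2.1) hf hgn
      (memLp_exp_neg hl (one_le_ofReal hα)) (memLp_exp_neg hl one_le_two)
  have h2 : Tendsto (fun n => lap l (fun s => ι (un n s))) atTop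
      (𝓝 (lap l (fun s => ι (u s)))) := by
    refine tendsto_lap_of_memLp (fun n => (hn n).1.2) hu.2 ?_ hl
    refine tendsto_of_tendsto_of_tendsto_of_le_of_le tendsto_const_nhds hun
      (fun _ => zero_le) fun n => ?_
    simp only [← map_sub]
    exact le_max_right _ _
  have h3 : Tendsto (fun n => lap l (fun s => toDual ι (ι (un n s)))) atTop
      (𝓝 (lap l (fun s => toDual ι (ι (u s))))) := by
    have h4 := ((toDualL ι).continuous.tendsto _).comp h2
    have h5 : ∀ {w : ℝ → V}, MemV ι α w →
        toDualL ι (lap l fun s => ι (w s)) = lap l (fun s => toDual ι (ι (w s))) :=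
      fun hw => (lap_comp_clm (toDualL ι) hw.expIntegrable hl).symm
    rw [h5 hu] at h4
    exact h4.congr fun n => h5 (hn n).1
  refine tendsto_nhds_unique h1 ?_
  exact ((h3.const_smul (bernsteinFun k l)).neg).congr fun n => ((hrel n).eq l hl).symm

end Closure

/-! ### Weak derivatives of primitives and their uniqueness -/

section Sobolev

variable {E : Type*} [NormedAddCommGroup E] [NormedSpace ℝ E] {k : ℝ → ℝ}

lemma ExpIntegrable.integrableOn_Ioo {v : ℝ → E} (hv : ExpIntegrable v) (T : ℝ) :
    IntegrableOn v (Ioo 0 T) := (hv.integrableOn T).mono_set Ioo_subset_Icc_self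

/-- Fubini on the triangle `s < t`: the inner integral of `φ'` over `(s,T)` is `-φ s`, as `φ T = 0`.
-/
lemma integral_deriv_smul_prim [CompleteSpace E] {f : ℝ → E} {T : ℝ}
    (hf : IntegrableOn f (Ioo 0 T)) {φ : ℝ → ℝ} (hφ : ContDiff ℝ ∞ φ)
    (hφs : tsupport φ ⊆ Ioo 0 T) :
    ∫ t in Ioo 0 T, deriv φ t • prim f t = -∫ t in Ioo 0 T, φ t • f t := by
  have hφT : φ T = 0 := by
    by_contra h
    exact lt_irrefl _ (hφs (subset_tsupport _ h)).2
  have hdc : Continuous (deriv φ) := hφ.continuous_deriv (by simp)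
  have hdi : IntegrableOn (deriv φ) (Ioo 0 T) :=
    (hdc.integrableOn_Icc).mono_set Ioo_subset_Icc_self
  set S : Set (ℝ × ℝ) := {z | z.2 < z.1} with hS
  have hSm : MeasurableSet S := measurableSet_lt measurable_snd measurable_fst
  have hprod : Integrable (Function.uncurry fun t s =>
      S.indicator (fun z : ℝ × ℝ => deriv φ z.1 • f z.2) (t, s))
      ((volume.restrict (Ioo 0 T)).prod (volume.restrict (Ioo 0 T))) :=
    (Integrable.smul_prod hdi hf).indicator hSm
  have h1 : ∀ t ∈ Ioo 0 T, deriv φ t • prim f t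
      = ∫ s in Ioo 0 T, S.indicator (fun z : ℝ × ℝ => deriv φ z.1 • f z.2) (t, s) := by
    intro t ht
    have h2 : (fun s => S.indicator (fun z : ℝ × ℝ => deriv φ z.1 • f z.2) (t, s))
        = (Iio t).indicator fun s => deriv φ t • f s := by
      funext s
      by_cases hs : s < t <;> simp [hS, indicator, hs]
    rw [h2, setIntegral_indicator measurableSet_Iio, integral_smul, prim_eq, Ioo_inter_Iio,
      min_eq_right ht.2.le]
  have h3 : ∀ s ∈ Ioo 0 T, ∫ t in Ioo 0 T,
      S.indicator (fun z : ℝ × ℝ => deriv φ z.1 • f z.2) (t, s) = -(φ s • f s) := by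
    intro s hs
    have h2 : (fun t => S.indicator (fun z : ℝ × ℝ => deriv φ z.1 • f z.2) (t, s))
        = (Ioi s).indicator fun t => deriv φ t • f s := by
      funext t
      by_cases hs : s < t <;> simp [hS, indicator, hs]
    have h4 : Ioo 0 T ∩ Ioi s = Ioo s T := by
      rw [Ioo_inter_Ioi, max_eq_right hs.1.le]
    rw [h2, setIntegral_indicator measurableSet_Ioi, h4, integral_smul_const,
      ← integral_Ioc_eq_integral_Ioo, ← intervalIntegral.integral_of_le hs.2.le,
      intervalIntegral.integral_deriv_eq_sub
        (fun x _ => (hφ.differentiable (by simp)).differentiableAt)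
        (hdc.intervalIntegrable _ _), hφT, zero_sub, neg_smul]
  rw [setIntegral_congr_fun measurableSet_Ioo h1, integral_integral_swap hprod,
    setIntegral_congr_fun measurableSet_Ioo h3, integral_neg]

lemma ae_restrict_Ioo_of_timeMeasure {P : ℝ → Prop} (h : ∀ᵐ t ∂timeMeasure, P t) (T : ℝ) :
    ∀ᵐ t ∂volume.restrict (Ioo 0 T), P t :=
  ae_restrict_of_ae_restrict_of_subset (Ioo_subset_Ioi_self.trans Ioi_subset_Ici_self) h

theorem LapRel.isFracDeriv [CompleteSpace E] (hk : KernelCond k) {v g : ℝ → E}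
    (h : LapRel k v g) : IsFracDeriv k v (fun s => -g s) := by
  intro T _
  refine ⟨(lap_conv hk.expIntegrable h.left).1.integrableOn_Ioo T,
    (h.right.integrableOn_Ioo T).neg, fun φ hφ _ hφs => ?_⟩
  have h1 : ∫ t in Ioo 0 T, deriv φ t • conv k v t = ∫ t in Ioo 0 T, -(deriv φ t • prim g t) := by
    refine integral_congr_ae ?_
    filter_upwards [ae_restrict_Ioo_of_timeMeasure (h.conv_eq hk) T] with t ht
    rw [ht, smul_neg]
  rw [h1, integral_neg, integral_deriv_smul_prim (h.right.integrableOn_Ioo T) hφ hφs]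
  simp only [smul_neg, integral_neg]

/-- Uniqueness of the weak derivative. -/
theorem IsFracDeriv.ae_eq [CompleteSpace E] {v g g' : ℝ → E} (h : IsFracDeriv k v g)
    (h' : IsFracDeriv k v g') : g =ᵐ[timeMeasure] g' := by
  have key : ∀ n : ℕ, ∀ᵐ t, t ∈ Ioo (0 : ℝ) (n + 1) → g t - g' t = 0 := by
    intro n
    obtain ⟨-, h1, h2⟩ := h (n + 1) (by positivity)
    obtain ⟨-, h3, h4⟩ := h' (n + 1) (by positivity)
    have h13 : IntegrableOn (fun t => g t - g' t) (Ioo (0 : ℝ) (n + 1)) := h1.sub h3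
    refine isOpen_Ioo.ae_eq_zero_of_integral_contDiff_smul_eq_zero
      h13.locallyIntegrableOn fun φ hφ hφc hφs => ?_
    have hi : ∀ {w : ℝ → E}, IntegrableOn w (Ioo (0 : ℝ) (n + 1)) →
        IntegrableOn (fun t => φ t • w t) (Ioo (0 : ℝ) (n + 1)) := by
      intro w hw
      obtain ⟨C, hC⟩ := hφ.continuous.bounded_above_of_compact_support hφc
      exact hw.bdd_smul C hφ.continuous.aestronglyMeasurable (Eventually.of_forall hC)
    rw [← setIntegral_eq_integral_of_forall_compl_eq_zero (s := Ioo (0 : ℝ) (n + 1))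
      fun t ht => by rw [image_eq_zero_of_notMem_tsupport fun h => ht (hφs h), zero_smul]]
    simp only [smul_sub]
    rw [integral_sub (hi h1) (hi h3), sub_eq_zero, ← neg_inj, ← h2 φ hφ hφc hφs,
      ← h4 φ hφ hφc hφs]
  rw [timeMeasure_eq]
  refine (ae_restrict_iff' measurableSet_Ioi).2 ?_
  filter_upwards [ae_all_iff.2 key] with t ht ht0
  obtain ⟨n, hn⟩ := exists_nat_gt t
  exact sub_eq_zero.1 (ht n ⟨ht0, hn.trans (lt_add_one _)⟩)

end Sobolev

/-! ### Energy identity and continuity of primitives -/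

section Continuity

variable {H : Type*} [NormedAddCommGroup H] [InnerProductSpace ℝ H] [CompleteSpace H]

/-- The square `(0,T)²` splits, up to the null diagonal, into two triangles on which the symmetric
kernel `⟨G s, G r⟩` has equal integrals. No differentiation of the primitive is involved. -/
lemma norm_prim_sq {G : ℝ → H} {T : ℝ} (hG : IntegrableOn G (Ioo 0 T)) :
    ‖prim G T‖ ^ 2 = 2 * ∫ s in Ioo 0 T, inner ℝ (G s) (prim G s) := by
  set m := volume.restrict (Ioo 0 T) with hm
  have hGm : Integrable G m := hG
  set K : ℝ × ℝ → ℝ := fun z => inner ℝ (G z.1) (G z.2) with hK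
  have hKi : Integrable K (m.prod m) := by
    refine (hGm.norm.mul_prod hGm.norm).mono'
      (hGm.1.comp_fst.inner hGm.1.comp_snd) (Eventually.of_forall fun z => ?_)
    exact norm_inner_le_norm _ _
  set S : Set (ℝ × ℝ) := {z | z.2 < z.1} with hS
  have hSm : MeasurableSet S := measurableSet_lt measurable_snd measurable_fst
  set S' : Set (ℝ × ℝ) := {z | z.1 < z.2} with hS'
  have hSm' : MeasurableSet S' := measurableSet_lt measurable_fst measurable_snd
  have h1 : ∫ s in Ioo 0 T, inner ℝ (G s) (prim G s) = ∫ z, S.indicator K z ∂m.prod m := by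
    rw [integral_prod _ (hKi.indicator hSm)]
    refine setIntegral_congr_fun measurableSet_Ioo fun s hs => ?_
    have h2 : (fun r => S.indicator K (s, r)) = (Iio s).indicator fun r => inner ℝ (G s) (G r) := by
      funext r
      by_cases hr : r < s <;> simp [hS, hK, indicator, hr]
    simp only [h2]
    rw [hm, setIntegral_indicator measurableSet_Iio, Ioo_inter_Iio, min_eq_right hs.2.le,
      integral_inner (hG.mono_set (Ioo_subset_Ioo_right hs.2.le)), prim_eq]
  have h3 : ∫ z, S'.indicator K z ∂m.prod m = ∫ z, S.indicator K z ∂m.prod m := by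
    rw [← integral_prod_swap (fun z => S.indicator K z)]
    refine integral_congr_ae (Eventually.of_forall fun z => ?_)
    by_cases hz : z.1 < z.2 <;> simp [hS, hS', hK, indicator, hz, real_inner_comm]
  have h4 : ∫ z, K z ∂m.prod m = ‖prim G T‖ ^ 2 := by
    rw [integral_prod _ hKi]
    simp only [hK]
    have h5 : ∀ s, ∫ r, inner ℝ (G s) (G r) ∂m = inner ℝ (prim G T) (G s) := fun s => by
      rw [integral_inner hGm, prim_eq, real_inner_comm]
    simp only [h5]
    rw [integral_inner hGm, ← prim_eq, real_inner_self_eq_norm_sq]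
  have h6 : K =ᵐ[m.prod m] fun z => S.indicator K z + S'.indicator K z := by
    have hd : ∀ᵐ z ∂m.prod m, z.1 ≠ z.2 := by
      rw [Measure.ae_prod_iff_ae_ae]
      · refine Eventually.of_forall fun s => ?_
        filter_upwards [Measure.ae_ne m s] with r hr using hr.symm
      · exact (measurableSet_eq_fun measurable_fst measurable_snd).compl
    filter_upwards [hd] with z hz
    rcases lt_or_gt_of_ne hz with h | h <;> simp [hS, hS', indicator, h, h.not_gt]
  rw [← h4, integral_congr_ae h6, integral_add (hKi.indicator hSm) (hKi.indicator hSm'), h3, h1]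
  ring

lemma continuousOn_prim {E : Type*} [NormedAddCommGroup E] [NormedSpace ℝ E] {G : ℝ → E}
    (hG : ExpIntegrable G) : ContinuousOn (prim G) (Ici 0) := by
  have h1 : ∀ T : ℝ, ContinuousOn (prim G) (Icc 0 T) := by
    intro T
    refine (intervalIntegral.continuousOn_primitive (a := 0) (hG.integrableOn T)).congr
      fun t _ => ?_
    simp only [prim_eq, integral_Ioc_eq_integral_Ioo]
  intro t ht
  refine ((h1 (t + 1)) t ⟨ht, by linarith⟩).mono_of_mem_nhdsWithin ?_
  exact mem_nhdsWithin.2 ⟨Iio (t + 1), isOpen_Iio, by simp, fun s hs => ⟨hs.2, (le_of_lt hs.1)⟩⟩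

end Continuity

/-- Equality can fail at times where only one of the two defining integrals converges, so it is
obtained almost everywhere by comparing transforms. -/
lemma conv_comp_clm {E F : Type*} [NormedAddCommGroup E] [NormedSpace ℝ E] [CompleteSpace E]
    [NormedAddCommGroup F] [NormedSpace ℝ F] [CompleteSpace F] (A : E →L[ℝ] F) {κ : ℝ → ℝ}
    {v : ℝ → E} (hκ : ExpIntegrable κ) (hv : ExpIntegrable v) :
    conv κ (fun t => A (v t)) =ᵐ[timeMeasure] fun t => A (conv κ v t) := by
  obtain ⟨h1, h2⟩ := lap_conv hκ hv
  obtain ⟨h3, h4⟩ := lap_conv hκ (hv.comp_clm A)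
  have h := ae_eq_zero_of_lap_eq_zero (h3.sub (h1.comp_clm A)) fun l hl => by
    rw [lap_sub h3 (h1.comp_clm A) hl, h4 l hl, lap_comp_clm A h1 hl, h2 l hl,
      lap_comp_clm A hv hl, map_smul, sub_self]
  filter_upwards [h] with t ht
  exact sub_eq_zero.1 ht

/-! ### Energy estimate, continuous version, and coercivity on the closure -/

section Energy

variable {H : Type*} [NormedAddCommGroup H] [InnerProductSpace ℝ H]
  {V : Type*} [NormedAddCommGroup V] [NormedSpace ℝ V] {ι : V →L[ℝ] H} {α : ℝ} {k : ℝ → ℝ}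

/-- Energy estimate for `k * u = -∫ g` in `H`. -/
lemma enorm_prim_sq_le [CompleteSpace H] (hα : 1 < α) (hk : KernelCond k) {u : ℝ → V} {g : ℝ → H}
    (hu : MemV ι α u) (hg : MemLp g 2 timeMeasure) (h : LapRel k (fun s => ι (u s)) g)
    {t T : ℝ} (htT : t ≤ T) :
    ‖prim g t‖ₑ ^ 2 ≤ 2 * ((∫⁻ τ in Ioo 0 T, ‖k τ‖ₑ) * normV ι α u
      * normVDual ι α (fun s => toDual ι (g s))) := by
  have h1 := norm_prim_sq (h.right.integrableOn_Ioo t)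
  have h2 : ‖∫ s in Ioo 0 t, inner ℝ (g s) (prim g s)‖ₑ
      ≤ ∫⁻ r in Ioo 0 T, ‖inner ℝ (g r) (conv k (fun s => ι (u s)) r)‖ₑ := by
    refine (enorm_integral_le_lintegral_enorm _).trans ?_
    refine le_trans (le_of_eq ?_) (lintegral_mono_set (Ioo_subset_Ioo_right htT))
    refine lintegral_congr_ae ?_
    filter_upwards [ae_restrict_Ioo_of_timeMeasure (h.conv_eq hk) t] with s hs
    rw [hs, inner_neg_right, enorm_neg]
  calc ‖prim g t‖ₑ ^ 2 = ‖‖prim g t‖ ^ 2‖ₑ := by rw [enorm_pow, enorm_norm]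
    _ = 2 * ‖∫ s in Ioo 0 t, inner ℝ (g s) (prim g s)‖ₑ := by
        rw [h1, enorm_mul]
        congr 1
        rw [Real.enorm_eq_ofReal zero_le_two]
        simp
    _ ≤ _ := mul_le_mul' le_rfl
        (h2.trans (lintegral_enorm_inner_conv_le hα hk.expIntegrable hg hu T))

lemma prim_sub {E : Type*} [NormedAddCommGroup E] [NormedSpace ℝ E] {g g' : ℝ → E}
    (h : ExpIntegrable g) (h' : ExpIntegrable g') (t : ℝ) :
    prim (fun s => g s - g' s) t = prim g t - prim g' t := by
  simp only [prim_eq]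
  exact integral_sub (h.integrableOn_Ioo t) (h'.integrableOn_Ioo t)

/-- The primitive at `t` is the integral against the indicator of `(0,t)`, which lies in both `L^α`
and `L²`. -/
lemma tendsto_prim_of_normVDual (hα : 1 < α) {F : ℕ → ℝ → StrongDual ℝ V}
    {f : ℝ → StrongDual ℝ V} (hF : ∀ n, MemVDual ι α (F n)) (hf : MemVDual ι α f)
    (hlim : Tendsto (fun n => normVDual ι α (fun s => F n s - f s)) atTop (𝓝 0)) (t : ℝ) :
    Tendsto (fun n => prim (F n) t) atTop (𝓝 (prim f t)) := by
  have hsub : Ioo 0 t ⊆ Ici (0 : ℝ) := Ioo_subset_Ioi_self.trans Ioi_subset_Ici_self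
  have ha : ∀ p : ℝ≥0∞, MemLp ((Ioo 0 t).indicator fun _ => (1 : ℝ)) p timeMeasure := fun p =>
    memLp_indicator_const p measurableSet_Ioo 1 (Or.inr (by
      rw [Measure.restrict_apply measurableSet_Ioo]
      exact ((measure_mono inter_subset_left).trans_lt measure_Ioo_lt_top).ne))
  have h1 : ∀ G : ℝ → StrongDual ℝ V,
      ∫ s, (Ioo 0 t).indicator (fun _ => (1 : ℝ)) s • G s ∂timeMeasure = prim G t := by
    intro G
    have h2 : (fun s => (Ioo 0 t).indicator (fun _ => (1 : ℝ)) s • G s)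
        = (Ioo 0 t).indicator G := by
      funext s
      by_cases hs : s ∈ Ioo 0 t <;> simp [indicator, hs]
    rw [h2, integral_indicator measurableSet_Ioo, Measure.restrict_restrict measurableSet_Ioo,
      inter_eq_left.2 hsub, prim_eq]
  simpa only [h1] using tendsto_integral_smul_of_normVDual hα hF hf hlim (ha _) (ha 2)

/-- For `u` in the domain of the closure, `k * u` has a version that is continuous in `H`. -/
theorem ClosureGraph.exists_continuousOn [CompleteSpace H] (hα : 1 < α) (hk : KernelCond k)
    (hdense : DenseRange ι) {u : ℝ → V} {f : ℝ → StrongDual ℝ V} (h : ClosureGraph ι α k u f) :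
    ∃ w : ℝ → H, ContinuousOn w (Ici 0) ∧ w =ᵐ[timeMeasure] conv k (fun s => ι (u s)) := by
  have hrel := h.lapRel hα hk
  obtain ⟨hu, hf, un, gn, hn, hun, hgn⟩ := h
  set a : ℕ → ℝ≥0∞ := fun n => normV ι α (fun s => un n s - u s) with ha
  set b : ℕ → ℝ≥0∞ := fun n => normVDual ι α (fun s => toDual ι (gn n s) - f s) with hb
  have hreln : ∀ n, LapRel k (fun s => ι (un n s)) (gn n) := fun n => (hn n).2.lapRel hk
  -- The energy estimate is applied to differences of approximants, whose primitives need not be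
  -- controlled in `H` by the norm of `𝓥*` alone.
  have hest : ∀ T t : ℝ, t ≤ T → ∀ n m, ‖prim (gn n) t - prim (gn m) t‖ₑ ^ 2
      ≤ 2 * ((∫⁻ τ in Ioo 0 T, ‖k τ‖ₑ) * (a n + a m) * (b n + b m)) := by
    intro T t htT n m
    have h1 : LapRel k (fun s => ι (un n s - un m s)) (fun s => gn n s - gn m s) := by
      simpa only [map_sub] using (hreln n).sub (hreln m)
    have hg : MemLp (fun s => gn n s - gn m s) 2 timeMeasure := (hn n).2.2.1.sub (hn m).2.2.1
    have h2 := enorm_prim_sq_le hα hk ((hn n).1.sub (hn m).1) hg h1 htT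
    rw [prim_sub (hreln n).right (hreln m).right] at h2
    refine h2.trans ?_
    have h3 : normV ι α (fun s => un n s - un m s) ≤ a n + a m := by
      have := normV_sub_le hα ((hn n).1.sub hu) ((hn m).1.sub hu)
      simpa only [sub_sub_sub_cancel_right] using this
    have h4 : normVDual ι α (fun s => toDual ι (gn n s - gn m s)) ≤ b n + b m := by
      have := normVDual_sub_le (ι := ι) hα (fun s => toDual ι (gn n s) - f s)
        (fun s => toDual ι (gn m s) - f s)
      simpa only [sub_sub_sub_cancel_right, toDual_sub] using this
    gcongr
  have hcauchy : ∀ T : ℝ, UniformCauchySeqOn (fun n => prim (gn n)) atTop (Icc 0 T) := by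
    intro T U hU
    obtain ⟨ε, hε, hεU⟩ := mem_uniformity_edist.1 hU
    have hC : ∫⁻ τ in Ioo 0 T, ‖k τ‖ₑ ≠ ⊤ := (hk.expIntegrable.integrableOn_Ioo T).2.ne
    have h1 : Tendsto (fun p : ℕ × ℕ => a p.1 + a p.2) (atTop ×ˢ atTop) (𝓝 (0 + 0)) :=
      (hun.comp tendsto_fst).add (hun.comp tendsto_snd)
    have h2 : Tendsto (fun p : ℕ × ℕ => b p.1 + b p.2) (atTop ×ˢ atTop) (𝓝 (0 + 0)) :=
      (hgn.comp tendsto_fst).add (hgn.comp tendsto_snd)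
    rw [add_zero] at h1 h2
    have h3 := ENNReal.Tendsto.const_mul (ENNReal.Tendsto.mul
      (ENNReal.Tendsto.const_mul h1 (Or.inr hC)) (Or.inr ENNReal.zero_ne_top) h2
      (Or.inr (by simp))) (Or.inr (ENNReal.ofNat_ne_top (n := 2)))
    simp only [mul_zero] at h3
    filter_upwards [h3.eventually (gt_mem_nhds (ENNReal.pow_pos hε 2))] with p hp t ht
    refine hεU ?_
    rw [edist_eq_enorm_sub]
    exact lt_of_not_ge fun h =>
      not_le.2 ((hest T t ht.2 p.1 p.2).trans_lt hp) (pow_le_pow_left' h 2)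
  have hptw : ∀ t : ℝ, ∃ y : H, 0 ≤ t → Tendsto (fun n => prim (gn n) t) atTop (𝓝 y) := by
    intro t
    by_cases ht : 0 ≤ t
    · obtain ⟨y, hy⟩ := cauchySeq_tendsto_of_complete
        ((hcauchy t).cauchySeq (x := t) (right_mem_Icc.2 ht))
      exact ⟨y, fun _ => hy⟩
    · exact ⟨0, fun h => absurd h ht⟩
  choose y hy using hptw
  -- The sign comes from `k * u = -∫₀^· f`.
  refine ⟨fun t => -y t, ContinuousOn.neg fun t ht => ?_, ?_⟩
  · have h1 : ContinuousOn y (Icc 0 (t + 1)) := by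
      refine ((hcauchy (t + 1)).tendstoUniformlyOn_of_tendsto fun s hs => hy s hs.1).continuousOn ?_
      exact (Eventually.of_forall fun n =>
        (continuousOn_prim (hreln n).right).mono Icc_subset_Ici_self).frequently
    refine (h1 t ⟨ht, by linarith⟩).mono_of_mem_nhdsWithin ?_
    exact mem_nhdsWithin.2 ⟨Iio (t + 1), isOpen_Iio, by simp, fun s hs => ⟨hs.2, le_of_lt hs.1⟩⟩
  · have h1 : ∀ t : ℝ, 0 ≤ t → toDual ι (y t) = prim f t := by
      intro t ht
      have h2 := ((toDualL ι).continuous.tendsto _).comp (hy t ht)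
      refine tendsto_nhds_unique h2 ((tendsto_prim_of_normVDual hα
        (fun n => memVDual_toDual (hn n).2.2.1) hf hgn t).congr fun n => ?_)
      simp only [prim_eq, Function.comp_apply]
      exact (toDualL ι).integral_comp_comm ((hreln n).right.integrableOn_Ioo t)
    filter_upwards [hrel.conv_eq hk, ae_restrict_mem measurableSet_Ici,
      conv_comp_clm (toDualL ι) hk.expIntegrable hu.expIntegrable] with t ht1 ht2 ht3
    refine toDual_injective hdense ?_
    have h2 : toDual ι (-y t) = -toDual ι (y t) := (toDualL ι).map_neg _
    rw [h2, h1 t ht2, ← ht1]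
    exact ht3

lemma integrable_pairing (hα : 1 < α) {f : ℝ → StrongDual ℝ V} (hf : MemVDual ι α f) {u : ℝ → V}
    (hu : MemV ι α u) {γ : ℝ} (hγ : 0 < γ) :
    Integrable (fun s => f s (u s) * Real.exp (-(γ * s))) timeMeasure := by
  have h1 : Integrable (fun s => f s (u s)) timeMeasure := by
    refine ⟨isBoundedBilinearMap_apply.continuous.comp_aestronglyMeasurable₂
      (hf.expIntegrable hα).aestronglyMeasurable hu.1.1, ?_⟩
    exact (lintegral_enorm_pairing_le hα hf hu).trans_lt
      (ENNReal.mul_lt_top (normV_lt_top hu) (normVDual_lt_top hf))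
  simpa [mul_comm] using expIntegrable_of_integrable h1 γ hγ

/-- Joint continuity of the duality, by expanding `Fₙ(Uₙ) - f(u)` into `(Fₙ - f)(Uₙ - u) + (Fₙ -
f)(u) + f(Uₙ - u)`; the exponential weight is at most `1`. -/
lemma tendsto_integral_pairing (hα : 1 < α) {F : ℕ → ℝ → StrongDual ℝ V}
    {f : ℝ → StrongDual ℝ V} (hF : ∀ n, MemVDual ι α (F n)) (hf : MemVDual ι α f)
    (hlim : Tendsto (fun n => normVDual ι α (fun s => F n s - f s)) atTop (𝓝 0))
    {U : ℕ → ℝ → V} {u : ℝ → V} (hU : ∀ n, MemV ι α (U n)) (hu : MemV ι α u)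
    (hUlim : Tendsto (fun n => normV ι α (fun s => U n s - u s)) atTop (𝓝 0))
    {γ : ℝ} (hγ : 0 < γ) :
    Tendsto (fun n => ∫ s, F n s (U n s) * Real.exp (-(γ * s)) ∂timeMeasure) atTop
      (𝓝 (∫ s, f s (u s) * Real.exp (-(γ * s)) ∂timeMeasure)) := by
  refine tendsto_integral_of_L1 _ (integrable_pairing hα hf hu hγ).aestronglyMeasurable
    (Eventually.of_forall fun n => integrable_pairing hα (hF n) (hU n) hγ) ?_
  have h1 : Tendsto (fun n => normV ι α (fun s => U n s - u s)
        * normVDual ι α (fun s => F n s - f s)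
      + (normV ι α u * normVDual ι α (fun s => F n s - f s)
      + normV ι α (fun s => U n s - u s) * normVDual ι α f)) atTop
      (𝓝 (0 * 0 + (normV ι α u * 0 + 0 * normVDual ι α f))) :=
    (ENNReal.Tendsto.mul hUlim (Or.inr (by simp)) hlim (Or.inr (by simp))).add
      ((ENNReal.Tendsto.const_mul hlim (Or.inr (normV_lt_top hu).ne)).add
        (ENNReal.Tendsto.mul_const hUlim (Or.inr (normVDual_lt_top hf).ne)))
  simp only [mul_zero, zero_mul, add_zero] at h1
  refine tendsto_of_tendsto_of_tendsto_of_le_of_le tendsto_const_nhds h1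
    (fun _ => zero_le) fun n => ?_
  have hm : ∀ {f : ℝ → StrongDual ℝ V} {u : ℝ → V}, MemVDual ι α f → MemV ι α u →
      AEMeasurable (fun s => ‖f s (u s)‖ₑ) timeMeasure := fun hf hu =>
    (isBoundedBilinearMap_apply.continuous.comp_aestronglyMeasurable₂
      (hf.expIntegrable hα).aestronglyMeasurable hu.1.1).enorm
  have hD := (hF n).sub hf
  have hE := (hU n).sub hu
  calc _ ≤ ∫⁻ s, (‖(F n s - f s) (U n s - u s)‖ₑ
        + (‖(F n s - f s) (u s)‖ₑ + ‖f s (U n s - u s)‖ₑ)) ∂timeMeasure := by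
        refine lintegral_mono_ae ?_
        filter_upwards [ae_restrict_mem measurableSet_Ici] with s hs
        have h2 : F n s (U n s) - f s (u s) = (F n s - f s) (U n s - u s)
            + ((F n s - f s) (u s) + f s (U n s - u s)) := by
          simp only [sub_apply, map_sub]; ring
        rw [← sub_mul, enorm_mul, h2]
        have h3 : ‖Real.exp (-(γ * s))‖ₑ ≤ 1 := by
          rw [Real.enorm_eq_ofReal (Real.exp_pos _).le]
          exact ENNReal.ofReal_le_one.2
            (Real.exp_le_one_iff.2 (neg_nonpos.2 (mul_nonneg hγ.le hs)))
        calc _ ≤ _ := mul_le_mul' le_rfl h3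
          _ ≤ _ := by
            rw [mul_one]
            exact (enorm_add_le _ _).trans (add_le_add le_rfl (enorm_add_le _ _))
    _ = ∫⁻ s, ‖(F n s - f s) (U n s - u s)‖ₑ ∂timeMeasure
        + (∫⁻ s, ‖(F n s - f s) (u s)‖ₑ ∂timeMeasure
          + ∫⁻ s, ‖f s (U n s - u s)‖ₑ ∂timeMeasure) := by
        rw [lintegral_add_left' (hm hD hE), lintegral_add_left' (hm hD hu)]
    _ ≤ _ := add_le_add (lintegral_enorm_pairing_le hα hD hE)
        (add_le_add (lintegral_enorm_pairing_le hα hD hu) (lintegral_enorm_pairing_le hα hf hE))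

lemma toDual_self_apply (x : V) : toDual ι (ι x) x = ‖ι x‖ ^ 2 := by
  rw [toDual_apply, real_inner_self_eq_norm_sq]

/-- Coercivity of the closure of the generator in exponentially weighted spaces. -/
theorem ClosureGraph.le_neg_integral [CompleteSpace H] (hα : 1 < α) (hk : KernelCond k) {u : ℝ → V}
    {f : ℝ → StrongDual ℝ V} (h : ClosureGraph ι α k u f) {γ : ℝ} (hγ : 0 < γ) :
    1 / 2 * bernsteinFun k γ * ∫ s, ‖ι (u s)‖ ^ 2 * Real.exp (-(γ * s)) ∂timeMeasure
      ≤ -∫ s, f s (u s) * Real.exp (-(γ * s)) ∂timeMeasure := by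
  obtain ⟨hu, hf, un, gn, hn, hun, hgn⟩ := h
  have h1 := tendsto_integral_pairing hα (fun n => memVDual_toDual (hn n).2.2.1) hf hgn
    (fun n => (hn n).1) hu hun hγ
  -- `‖ι u‖²` is the pairing of `u` with its own image in `V*`, so the lower bound converges by the
  -- same lemma. The decomposition `0 + ι(uₙ - u)` shows that `𝓥` embeds continuously in `𝓥*`.
  have h2 : Tendsto (fun n => normVDual ι α (fun s => toDual ι (ι (un n s)) - toDual ι (ι (u s))))
      atTop (𝓝 0) := by
    refine tendsto_of_tendsto_of_tendsto_of_le_of_le tendsto_const_nhds hun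
      (fun _ => zero_le) fun n => ?_
    have h3 : IsDecomp ι α (fun s => toDual ι (ι (un n s)) - toDual ι (ι (u s))) (fun _ => 0)
        (fun s => ι (un n s - u s)) :=
      ⟨memLp_zero_fun, ((hn n).1.sub hu).2, Eventually.of_forall fun s => by
        simp only [zero_add, map_sub, toDual_sub]⟩
    refine (normVDual_le h3).trans ?_
    rw [eLpNorm_zero_fun, zero_add]
    exact le_max_right _ _
  have h4 := tendsto_integral_pairing hα (fun n => memVDual_toDual (hn n).1.2)
    (memVDual_toDual hu.2) h2 (fun n => (hn n).1) hu hun hγ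
  simp only [toDual_self_apply] at h4
  refine le_of_tendsto_of_tendsto' (h4.const_mul _) h1.neg fun n => ?_
  exact (hn n).2.le_neg_integral hk hγ

end Energy

end GenFrac

end

/-! ### Assembly of the theorem -/

theorem theorem2p1
    {H : Type*} [NormedAddCommGroup H] [InnerProductSpace ℝ H] [CompleteSpace H]
    [TopologicalSpace.SeparableSpace H]
    {V : Type*} [NormedAddCommGroup V] [NormedSpace ℝ V] [CompleteSpace V]
    (hrefl : Function.Surjective (NormedSpace.inclusionInDoubleDual ℝ V))
    (ι : V →L[ℝ] H) (hinj : Function.Injective ι) (hdense : DenseRange ι)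
    (α : ℝ) (hα : 1 < α) (k : ℝ → ℝ) (hk : GenFrac.KernelCond k) :
    -- the closure of the graph is the graph of an operator
    (∀ u f f', GenFrac.ClosureGraph ι α k u f → GenFrac.ClosureGraph ι α k u f' →
      f =ᵐ[GenFrac.timeMeasure] f') ∧
    -- part (i)
    (∀ u f, GenFrac.ClosureGraph ι α k u f →
      GenFrac.MemFracDomain ι α k (fun s => GenFrac.toDual ι (ι (u s))) ∧
      GenFrac.IsFracDeriv k (fun s => GenFrac.toDual ι (ι (u s))) (fun s => -f s) ∧
      ∃ w : ℝ → H, ContinuousOn w (Ici 0) ∧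
        w =ᵐ[GenFrac.timeMeasure] GenFrac.conv k (fun s => ι (u s))) ∧
    -- part (ii)
    (∀ γ : ℝ, 0 < γ →
      Integrable (fun τ => 1 - Real.exp (-(τ * γ))) (GenFrac.levyMeasure k) ∧
      ((∃ s, 0 < s ∧ k s ≠ 0) → 0 < GenFrac.bernsteinFun k γ) ∧
      ∀ u f, GenFrac.ClosureGraph ι α k u f →
        ∀ g, GenFrac.IsFracDeriv k (fun s => GenFrac.toDual ι (ι (u s))) g →
          Integrable (fun s => g s (u s) * Real.exp (-(γ * s))) GenFrac.timeMeasure ∧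
          Integrable (fun s => ‖ι (u s)‖ ^ 2 * Real.exp (-(γ * s))) GenFrac.timeMeasure ∧
          1 / 2 * GenFrac.bernsteinFun k γ *
              ∫ s, ‖ι (u s)‖ ^ 2 * Real.exp (-(γ * s)) ∂GenFrac.timeMeasure ≤
            ∫ s, g s (u s) * Real.exp (-(γ * s)) ∂GenFrac.timeMeasure) := by
  -- Any weak derivative `g` agrees almost everywhere with `-f`. Taking `g = -f'` gives closability,
  -- and the general case moves the estimates for `f` to an arbitrary representative of the
  -- derivative.
  have huniq : ∀ u f g, GenFrac.ClosureGraph ι α k u f →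
      GenFrac.IsFracDeriv k (fun s => GenFrac.toDual ι (ι (u s))) g →
      g =ᵐ[GenFrac.timeMeasure] fun s => -f s := fun u f g h hg =>
    hg.ae_eq ((h.lapRel hα hk).isFracDeriv hk)
  refine ⟨fun u f f' h h' => ?_, fun u f h => ?_, fun γ hγ => ⟨GenFrac.integrable_levyMeasure hk hγ,
    GenFrac.bernsteinFun_pos hk hγ, fun u f h g hg => ⟨?_, ?_, ?_⟩⟩⟩
  · filter_upwards [huniq u f _ h ((h'.lapRel hα hk).isFracDeriv hk)] with s hs
    exact (neg_injective hs).symm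
  · have hd := (h.lapRel hα hk).isFracDeriv hk
    exact ⟨⟨GenFrac.memVDual_toDual h.1.2, fun T hT => ⟨_, hd T hT⟩⟩, hd,
      h.exists_continuousOn hα hk hdense⟩
  · refine (GenFrac.integrable_pairing hα h.2.1 h.1 hγ).neg.congr ?_
    filter_upwards [huniq u f g h hg] with s hs
    simp [hs]
  · simpa only [GenFrac.toDual_self_apply] using
      GenFrac.integrable_pairing hα (GenFrac.memVDual_toDual h.1.2) h.1 hγ
  · refine (h.le_neg_integral hα hk hγ).trans (le_of_eq ?_)
    rw [← integral_neg]
    refine integral_congr_ae ?_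
    filter_upwards [huniq u f g h hg] with s hs
    simp [hs]
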